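/- Let $s\ge 2$, $m=2s$, and let $1\le l\le m-1$ with $l\neq s$. Put $d=\gcd(s,l)$ and $d'=\gcd(s+l,2l)$ (so $d'\in\{d,2d\}$). Let $\mathbb F_q$ be the field with $q=2^m$ elements, let $\mathrm{Tr}_1^{k}$ denote the trace from $\mathbb F_{2^k}$ to $\mathbb F_2$, and let $$\mathcal K=\Big\{\big(\mathrm{Tr}_1^{s}(ax^{2^s+1})+\mathrm{Tr}_1^{m}(bx^{2^l+1}+cx)+h\big)_{x\in\mathbb F_q}:\ a\in\mathbb F_{2^s},\ b,c\in\mathbb F_q,\ h\in\mathbb F_2\Big\}$$ be the generalized-Kasami binary code of length $2^m$, with coordinates indexed by $\mathbb F_q$. Then $\mathcal K$ is affine-invariant, that is, it is an extended cyclic code, and every permutation $x\mapsto ax+b$ of the coordinates ($a\in\mathbb F_q^*$, $b\in\mathbb F_q$) maps $\mathcal K$ to itself. For every $i\ne 0$ such that $\mathcal K$ has a codeword of weight $i$, the supports of the codewords of weight $i$ form a (simple) $2$-$(2^m,i,\lambda)$ design for some $\lambda$: all of these supports have $i$ points, $2\le i\le 2^m$, and every pair of coordinates lies in exactly $\lambda$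 of them. Moreover, these are $2$-$(2^m,i,\lambda)$ designs for the following pairs $(i,\lambda)$. (1) If $d'=d$, with $X=2^{2(s+d)}-2^{2s+d}-2^{2s}+2^{s+2d}-2^{s+d}+2^{2d}$: - $i=2^{2s-1}-2^{s-1}$, $\ \lambda=\dfrac{2^{s-1}(2^s-1)(2^{2s-1}-2^{s-1}-1)\,X}{(2^{2d}-1)(2^s+1)}$; - $i=2^{2s-1}+2^{s-1}$, $\ \lambda=\dfrac{2^{s-1}(2^{2s-1}+2^{s-1}-1)\,X}{2^{2d}-1}$; - $i=2^{2s-1}-2^{s+d-1}$, $\ \lambda=\dfrac{2^{s-d-1}(2^{s-d}-1)(2^{s+d}-1)(2^{2s-1}-2^{s+d-1}-1)}{2^{2d}-1}$; - $i=2^{2s-1}+2^{s+d-1}$, $\ \lambda=\dfrac{2^{s-d-1}(2^{s-d}+1)(2^{s+d}-1)(2^{2s-1}+2^{s+d-1}-1)}{2^{2d}-1}$; - $i=2^{2s-1}$, $\ \lambda=(2^{2s-1}-1)(2^{3s-d}-2^{2s-2d}+1)$. (2) If $d'=2d$, with $Y=2^{2s}-2^{2(s-d)}-2^{2s-3d}+2^s-2^{s-d}+1$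 and $Z=2^s+2^{s-d}+2^{s-2d}+1$: - $i=2^{2s-1}\pm2^{s-1}$, $\ \lambda=\dfrac{2^{3d}\,Y\,i(i-1)}{(2^{2d}-1)(2^d+1)(2^s+1)}$; - $i=2^{2s-1}\pm2^{s+d-1}$, $\ \lambda=\dfrac{Z\,i(i-1)}{2^d(2^d+1)^2}$; - $i=2^{2s-1}$, $\ \lambda=(2^{2s-1}-1)\big(2^{3s-d}-2^{3s-2d}+2^{3s-3d}-2^{3s-4d}+2^{3s-5d}+2^{2s-d}-2^{2s-2d+1}+2^{2s-3d}-2^{2s-4d}+1\big)$; - $i=2^{2s-1}\pm2^{s+2d-1}$, $\ \lambda=\dfrac{(2^{s-d}-1)\,i(i-1)}{2^{4d}(2^d+1)(2^{2d}-1)}$. -/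

import Mathlib

/-- A simple `t`-`(v, k, lam)` design on the point set `P`: `P` has `v` points, `1 ≤ t ≤ k ≤ v`,
all blocks have `k` points, and every `t`-subset of `P` lies in exactly `lam` blocks. -/
structure IsDesign {P : Type*} [Fintype P] (t v k lam : ℕ) (blocks : Set (Finset P)) : Prop where
  card_points : Fintype.card P = v
  one_le_t : 1 ≤ t
  t_le_k : t ≤ k
  k_le_v : k ≤ v
  card_block : ∀ B ∈ blocks, B.card = k
  balanced : ∀ T : Finset P, T.card = t → {B | B ∈ blocks ∧ T ⊆ B}.ncard = lam

/-- The support of a binary word whose coordinates are indexed by `P`. -/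
def wordSupport {P : Type*} [Fintype P] (c : P → ZMod 2) : Finset P :=
  Finset.univ.filter fun x => c x ≠ 0

/-- The set of supports of all codewords of Hamming weight `i` in the code `C`. -/
def supportsOfWeight {P : Type*} [Fintype P] (C : Submodule (ZMod 2) (P → ZMod 2)) (i : ℕ) :
    Set (Finset P) :=
  {B | ∃ c ∈ C, hammingNorm c = i ∧ wordSupport c = B}

/-- The supports of the codewords of weight `i` in `C` form a `2`-`(v, i, lam)` design, where
`lam` is given as a rational number (which is thereby claimed to be a natural number). -/
def HoldsTwoDesign {P : Type*} [Fintype P] (C : Submodule (ZMod 2) (P → ZMod 2))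
    (v i : ℕ) (lam : ℚ) : Prop :=
  ∃ n : ℕ, (n : ℚ) = lam ∧ IsDesign 2 v i n (supportsOfWeight C i)

/-- The permutation automorphisms of a code: the coordinate permutations mapping `C` to itself. -/
def permAut {P : Type*} (C : Submodule (ZMod 2) (P → ZMod 2)) : Set (Equiv.Perm P) :=
  {σ | ∀ c : P → ZMod 2, (fun x => c (σ x)) ∈ C ↔ c ∈ C}

/-- The affine group of `F`: the permutations `x ↦ a x + b` with `a ≠ 0`. -/
def affinePerms (F : Type*) [Field F] : Set (Equiv.Perm F) :=
  {σ | ∃ a b : F, a ≠ 0 ∧ ∀ x, σ x = a * x + b}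

/-- A binary cyclic code of length `|F| - 1`, the coordinates being indexed by the powers
`1, α, α², …` of a generator `α` of `Fˣ`, i.e. by `Fˣ`. A cyclic shift of the coordinates is the
multiplication by `α`, and invariance under it is invariance under all of `Fˣ`. -/
def IsCyclicCode {F : Type*} [Field F] (C : Submodule (ZMod 2) (Fˣ → ZMod 2)) : Prop :=
  ∀ u : Fˣ, ∀ c ∈ C, (fun x => c (u * x)) ∈ C

/-- An extended cyclic code: a parity coordinate, indexed by `0 : F`, is appended to every word of
a cyclic code so that the sum of all coordinates vanishes. -/
def IsExtendedCyclicCode {F : Type*} [Field F] [Fintype F]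
    (C : Submodule (ZMod 2) (F → ZMod 2)) : Prop :=
  ∃ C₀ : Submodule (ZMod 2) (Fˣ → ZMod 2), IsCyclicCode C₀ ∧
    ∀ c : F → ZMod 2, c ∈ C ↔ (fun x : Fˣ => c x) ∈ C₀ ∧ ∑ x, c x = 0

/-- An affine-invariant code: an extended cyclic code whose permutation automorphism group contains
the affine group. -/
def IsAffineInvariant {F : Type*} [Field F] [Fintype F]
    (C : Submodule (ZMod 2) (F → ZMod 2)) : Prop :=
  IsExtendedCyclicCode C ∧ affinePerms F ⊆ permAut C

/-- The subfield of `F` consisting of the roots of `X ^ (2 ^ s) - X`; it is the subfield with `2 ^ s`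
elements when `F` has `2 ^ (2 * s)` elements. -/
def subfieldTwoPow (F : Type*) [Field F] [Algebra (ZMod 2) F] (s : ℕ) :
    IntermediateField (ZMod 2) F where
  carrier := {a | a ^ 2 ^ s = a}
  mul_mem' := by
    intro a b ha hb
    simp only [Set.mem_ofPred_eq] at *
    rw [mul_pow, ha, hb]
  add_mem' := by
    intro a b ha hb
    have : CharP F 2 := charP_of_injective_algebraMap (algebraMap (ZMod 2) F).injective 2
    simp only [Set.mem_ofPred_eq] at *
    rw [add_pow_char_pow, ha, hb]
  algebraMap_mem' := by
    intro r
    simp only [Set.mem_ofPred_eq]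
    rw [← map_pow, ZMod.pow_card_pow]
  inv_mem' := by
    intro a ha
    simp only [Set.mem_ofPred_eq] at *
    rw [inv_pow, ha]

/-- The element `x ^ (2 ^ s + 1)` of the subfield with `2 ^ s` elements, for `x` in the field `F`
with `2 ^ (2 * s)` elements. -/
def powToSubfield {F : Type*} [Field F] [Fintype F] [Algebra (ZMod 2) F] (s : ℕ)
    (hF : Fintype.card F = 2 ^ (2 * s)) (x : F) : subfieldTwoPow F s :=
  ⟨x ^ (2 ^ s + 1), by
    change (x ^ (2 ^ s + 1)) ^ 2 ^ s = x ^ (2 ^ s + 1)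
    have hx : x ^ 2 ^ (2 * s) = x := hF ▸ FiniteField.pow_card x
    rw [← pow_mul, add_mul, one_mul, ← pow_add, ← two_mul, pow_add, hx, pow_succ, mul_comm]⟩

/-- The binary code of length `2 ^ (2 * s)`, with coordinates indexed by the field `F` with
`2 ^ (2 * s)` elements, that consists of the words
`(Tr (a * x ^ (2 ^ s + 1)) + Tr (b * x ^ (2 ^ l + 1) + c * x) + h)_{x ∈ F}` with `a` in the subfield
with `2 ^ s` elements, `b, c` in `F`, and `h` in `ZMod 2`. -/
noncomputable def kasamiCode (F : Type*) [Field F] [Fintype F] [Algebra (ZMod 2) F] (s l : ℕ)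
    (hF : Fintype.card F = 2 ^ (2 * s)) : Submodule (ZMod 2) (F → ZMod 2) where
  carrier := {w | ∃ (a : subfieldTwoPow F s) (b c : F) (h : ZMod 2), w = fun x : F =>
    Algebra.trace (ZMod 2) (subfieldTwoPow F s) (a * powToSubfield s hF x) +
      Algebra.trace (ZMod 2) F (b * x ^ (2 ^ l + 1) + c * x) + h}
  zero_mem' := ⟨0, 0, 0, 0, by funext x; simp⟩
  add_mem' := by
    rintro _ _ ⟨a, b, c, h, rfl⟩ ⟨a', b', c', h', rfl⟩
    refine ⟨a + a', b + b', c + c', h + h', ?_⟩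
    funext x
    simp only [Pi.add_apply, add_mul, map_add]
    ring
  smul_mem' := by
    rintro r _ ⟨a, b, c, h, rfl⟩
    refine ⟨r • a, r • b, r • c, r * h, ?_⟩
    funext x
    simp only [Pi.smul_apply, smul_mul_assoc, ← smul_add, map_smul, smul_eq_mul]
    ring

/-! Substituting `u * x + v` for `x` in a word changes only its parameters, so the code is invariant
under the affine group. That group is 2-transitive on `F`, so every pair of coordinates lies in
equally many supports of a given weight. Counting flags gives `λ * v * (v - 1) = A_i * i * (i - 1)`
with `A_i` the number of words of weight `i`, and the theorem reduces to the weight distribution.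

With `q = 2 ^ (2 * s)`, a word of weight `i` has character sum `q - 2 * i`. The part depending on
`(a, b)` is a quadratic form; let `R` be the radical of its polar form. The character sum is `0` or
has square `q * |R|` (`walshSum_sq_eq_or`). By Parseval over `c` it is nonzero for exactly `q / |R|`
values of `c`, and `h` flips its sign. So the distribution depends only on how many pairs `(a, b)`
have a radical of each size.

The radical is the kernel of an operator of order two in `σ : x ↦ x ^ 2 ^ (s + l)`, whose fixed
field has `2 ^ d'` elements; hence `|R|` is `1`, `2 ^ d'` or `2 ^ (2 * d')`
(`exists_card_polarRadical`). The form also admits a Lagrangian subspace over the field with `2 ^ d`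
elements, so `q * |R|` is an even power of `2 ^ d`; for `d' = d` this excludes the middle size.

The class sizes solve a linear system: the number of pairs, the sum of `|R|`
(`sum_card_polarRadical`) and, for `d' = 2 * d`, the sum of the character sums
(`sum_walshSum_quadratic`). The last needs signs: for `d' = 2 * d` the forms are invariant under the
`(2 ^ d + 1)`-st roots of unity, so each sum is `1` modulo `2 ^ d + 1`
(`walshSum_quadratic_of_odd`). -/

/-! ### Designs from codes invariant under the affine group. -/

theorem card_wordSupport {P : Type*} [Fintype P] (c : P → ZMod 2) :
    (wordSupport c).card = hammingNorm c := by
  simp only [wordSupport, hammingNorm]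

theorem wordSupport_injective {P : Type*} [Fintype P] :
    Function.Injective (wordSupport : (P → ZMod 2) → Finset P) := by
  intro c c' h
  funext x
  have hx : c x ≠ 0 ↔ c' x ≠ 0 := by
    simpa [wordSupport] using congrArg (x ∈ ·) h
  generalize c x = u at hx
  generalize c' x = v at hx
  revert u v
  decide

theorem ncard_supportsOfWeight {P : Type*} [Fintype P] (C : Submodule (ZMod 2) (P → ZMod 2))
    (i : ℕ) : (supportsOfWeight C i).ncard = {c | c ∈ C ∧ hammingNorm c = i}.ncard := by
  rw [← Set.ncard_image_of_injective _ wordSupport_injective]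
  congr 1
  ext B
  simp [supportsOfWeight, and_assoc]

theorem map_mem_supportsOfWeight {P : Type*} [Fintype P]
    {C : Submodule (ZMod 2) (P → ZMod 2)} {i : ℕ} {σ : Equiv.Perm P} (hσ : σ ∈ permAut C)
    {B : Finset P} (hB : B ∈ supportsOfWeight C i) :
    B.map σ.toEmbedding ∈ supportsOfWeight C i := by
  obtain ⟨c, hc, hi, rfl⟩ := hB
  have hsupp : wordSupport (fun x => c (σ.symm x)) = (wordSupport c).map σ.toEmbedding := by
    ext x
    simp [wordSupport, Finset.mem_map_equiv]
  refine ⟨fun x => c (σ.symm x), ?_, ?_, hsupp⟩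
  · rw [← hσ]
    simpa using hc
  · rw [← card_wordSupport, hsupp, Finset.card_map, card_wordSupport, hi]

/-- The affine permutation `z ↦ a * z + b`. -/
noncomputable def affinePerm {F : Type*} [Field F] (a b : F) (ha : a ≠ 0) : Equiv.Perm F :=
  (Equiv.mulLeft₀ a ha).trans (Equiv.addRight b)

@[simp] theorem affinePerm_apply {F : Type*} [Field F] (a b : F) (ha : a ≠ 0) (z : F) :
    affinePerm a b ha z = a * z + b := rfl

theorem affinePerm_mem {F : Type*} [Field F] (a b : F) (ha : a ≠ 0) :
    affinePerm a b ha ∈ affinePerms F := ⟨a, b, ha, fun _ => rfl⟩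

theorem ncard_blocks_le_of_affine {F : Type*} [Field F] [Fintype F] [DecidableEq F]
    {C : Submodule (ZMod 2) (F → ZMod 2)} (hC : affinePerms F ⊆ permAut C) (i : ℕ)
    {x y x' y' : F} (hxy : x ≠ y) (hxy' : x' ≠ y') :
    {B | B ∈ supportsOfWeight C i ∧ ({x, y} : Finset F) ⊆ B}.ncard ≤
      {B | B ∈ supportsOfWeight C i ∧ ({x', y'} : Finset F) ⊆ B}.ncard := by
  have h0 : y - x ≠ 0 := sub_ne_zero.mpr hxy.symm
  have ha : (y' - x') / (y - x) ≠ 0 := div_ne_zero (sub_ne_zero.mpr hxy'.symm) h0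
  -- The unique affine map with `x ↦ x'` and `y ↦ y'`; it carries blocks through the first pair
  -- injectively to blocks through the second. Equality of the counts follows by exchanging the
  -- pairs.
  set σ := affinePerm ((y' - x') / (y - x)) (x' - (y' - x') / (y - x) * x) ha with hσ
  have hσx : σ x = x' := by simp [hσ]
  have hσy : σ y = y' := by
    simp only [hσ, affinePerm_apply]
    field_simp
    ring
  refine Set.ncard_le_ncard_of_injOn (fun B => B.map σ.toEmbedding) ?_ ?_ (Set.toFinite _)
  · rintro B ⟨hB, hT⟩
    refine ⟨map_mem_supportsOfWeight (hC (affinePerm_mem _ _ _)) hB, ?_⟩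
    have := Finset.map_subset_map (f := σ.toEmbedding) |>.mpr hT
    simpa [Finset.map_insert, hσx, hσy] using this
  · intro B _ B' _ h
    exact Finset.map_injective _ h

/-- Double counting of the ordered pairs of distinct points in the blocks. -/
theorem card_pairs_mul_eq {P : Type*} [Fintype P] [DecidableEq P] (S : Set (Finset P)) (i n : ℕ)
    (hS : ∀ B ∈ S, B.card = i)
    (hn : ∀ x y : P, x ≠ y → {B | B ∈ S ∧ ({x, y} : Finset P) ⊆ B}.ncard = n) :
    n * (Fintype.card P * (Fintype.card P - 1)) = S.ncard * (i * (i - 1)) := by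
  classical
  have key := Finset.sum_card_bipartiteAbove_eq_sum_card_bipartiteBelow
    (s := (Finset.univ : Finset P).offDiag) (t := S.toFinset)
    (fun p B => p.1 ∈ B ∧ p.2 ∈ B)
  have h1 : ∀ p ∈ (Finset.univ : Finset P).offDiag,
      (Finset.bipartiteAbove (fun (p : P × P) (B : Finset P) => p.1 ∈ B ∧ p.2 ∈ B)
        S.toFinset p).card = n := by
    intro p hp
    rw [← hn p.1 p.2 (by simpa using hp), Set.ncard_eq_toFinset_card']
    congr 1
    ext B
    simp only [Finset.bipartiteAbove, Finset.mem_filter, Set.mem_toFinset, Set.mem_ofPred_eq,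
      Finset.insert_subset_iff, Finset.singleton_subset_iff]
  have h2 : ∀ B ∈ S.toFinset,
      (Finset.bipartiteBelow (fun (p : P × P) (B : Finset P) => p.1 ∈ B ∧ p.2 ∈ B)
        (Finset.univ : Finset P).offDiag B).card = i * (i - 1) := by
    intro B hB
    have : (Finset.bipartiteBelow (fun (p : P × P) (B : Finset P) => p.1 ∈ B ∧ p.2 ∈ B)
        (Finset.univ : Finset P).offDiag B) = B.offDiag := by
      ext p
      simp only [Finset.bipartiteBelow, Finset.mem_filter, Finset.mem_offDiag, Finset.mem_univ,
        true_and]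
      tauto
    rw [this, Finset.offDiag_card, hS B (by simpa using hB), Nat.mul_sub_one]
  rw [Finset.sum_congr rfl h1, Finset.sum_congr rfl h2] at key
  simp only [Finset.sum_const, smul_eq_mul, Finset.offDiag_card, Finset.card_univ] at key
  rw [Set.ncard_eq_toFinset_card', ← key, Nat.mul_sub_one, mul_comm]

/-- A code invariant under the affine group holds `2`-designs, and the number of codewords
determines the parameter of the design. -/
theorem exists_isDesign_of_affine {F : Type*} [Field F] [Fintype F]
    {C : Submodule (ZMod 2) (F → ZMod 2)} (hC : affinePerms F ⊆ permAut C) {i : ℕ}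
    (hi : 2 ≤ i) (hiF : i ≤ Fintype.card F) :
    ∃ n, IsDesign 2 (Fintype.card F) i n (supportsOfWeight C i) ∧
      n * (Fintype.card F * (Fintype.card F - 1)) =
        {c | c ∈ C ∧ hammingNorm c = i}.ncard * (i * (i - 1)) := by
  classical
  have hcard : ∀ B ∈ supportsOfWeight C i, B.card = i := by
    rintro B ⟨c, -, hi, rfl⟩
    rw [card_wordSupport, hi]
  have hn : ∀ x y : F, x ≠ y → {B | B ∈ supportsOfWeight C i ∧ ({x, y} : Finset F) ⊆ B}.ncard =
      {B | B ∈ supportsOfWeight C i ∧ ({0, 1} : Finset F) ⊆ B}.ncard := fun x y hxy =>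
    le_antisymm (ncard_blocks_le_of_affine hC i hxy zero_ne_one)
      (ncard_blocks_le_of_affine hC i zero_ne_one hxy)
  refine ⟨{B | B ∈ supportsOfWeight C i ∧ ({0, 1} : Finset F) ⊆ B}.ncard,
    ⟨rfl, by norm_num, hi, hiF, hcard, ?_⟩, ?_⟩
  rotate_left
  · rw [← ncard_supportsOfWeight]
    exact card_pairs_mul_eq _ i _ hcard hn
  · intro T hT
    obtain ⟨x, y, hxy, rfl⟩ := Finset.card_eq_two.mp hT
    exact hn x y hxy

theorem holdsTwoDesign_of_affine {F : Type*} [Field F] [Fintype F]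
    {C : Submodule (ZMod 2) (F → ZMod 2)} (hC : affinePerms F ⊆ permAut C) {v i : ℕ} {lam : ℚ}
    (hv : Fintype.card F = v) (hi : 2 ≤ i) (hiF : i ≤ v)
    (hlam : lam * (v * (v - 1)) =
      ({c | c ∈ C ∧ hammingNorm c = i}.ncard : ℚ) * (i * (i - 1))) :
    HoldsTwoDesign C v i lam := by
  subst hv
  obtain ⟨n, hD, hn⟩ := exists_isDesign_of_affine hC hi hiF
  refine ⟨n, ?_, hD⟩
  have h1 : 1 ≤ i := by omega
  have h2 : 1 ≤ Fintype.card F := by omega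
  have hn' : (n : ℚ) * (Fintype.card F * (Fintype.card F - 1)) =
      ({c | c ∈ C ∧ hammingNorm c = i}.ncard : ℚ) * (i * (i - 1)) := by
    have := congrArg (Nat.cast (R := ℚ)) hn
    push_cast [Nat.cast_sub h1, Nat.cast_sub h2] at this
    exact this
  have hq : (2 : ℚ) ≤ Fintype.card F := by exact_mod_cast hi.trans hiF
  refine mul_right_cancel₀ (b := (Fintype.card F * (Fintype.card F - 1) : ℚ)) ?_
    (hn'.trans hlam.symm)
  have : (Fintype.card F : ℚ) - 1 ≠ 0 := by linarith
  have : (Fintype.card F : ℚ) ≠ 0 := by linarith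
  positivity

/-! ### Frobenius powers, traces and subfields in characteristic two. -/

section FiniteFieldCharTwo

variable {F : Type*} [Field F] [Algebra (ZMod 2) F]

theorem charP_two_of_algebra (F : Type*) [Field F] [Algebra (ZMod 2) F] : CharP F 2 :=
  charP_of_injective_algebraMap (algebraMap (ZMod 2) F).injective 2

theorem add_pow_two_pow (x y : F) (n : ℕ) : (x + y) ^ 2 ^ n = x ^ 2 ^ n + y ^ 2 ^ n := by
  have := charP_two_of_algebra F
  exact add_pow_char_pow x y 2 n

theorem pow_two_pow_pow {F : Type*} [Monoid F] (x : F) (i j : ℕ) :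
    (x ^ 2 ^ i) ^ 2 ^ j = x ^ 2 ^ (i + j) := by
  rw [← pow_mul, pow_add]

theorem pow_two_pow_comm {F : Type*} [Monoid F] (x : F) (i j : ℕ) :
    (x ^ 2 ^ i) ^ 2 ^ j = (x ^ 2 ^ j) ^ 2 ^ i := by
  rw [pow_two_pow_pow, pow_two_pow_pow, add_comm]

variable [Fintype F]

theorem pow_two_pow_card {F : Type*} [Field F] [Fintype F] {m : ℕ} (hF : Fintype.card F = 2 ^ m)
    (x : F) : x ^ 2 ^ m = x :=
  hF ▸ FiniteField.pow_card x

theorem trace_pow_two_pow (x : F) (n : ℕ) :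
    Algebra.trace (ZMod 2) F (x ^ 2 ^ n) = Algebra.trace (ZMod 2) F x := by
  induction n with
  | zero => simp
  | succ n ih =>
    rw [pow_succ, pow_mul, ← ih]
    have := Algebra.trace_eq_of_algEquiv
      (FiniteField.frobeniusAlgEquivOfAlgebraic (ZMod 2) F) (x ^ 2 ^ n)
    simpa using this

/-- The adjoint of a power of the Frobenius with respect to the trace form. -/
theorem trace_mul_pow_two_pow {m t : ℕ} (hF : Fintype.card F = 2 ^ m) (ht : t ≤ m) (g x : F) :
    Algebra.trace (ZMod 2) F (g * x ^ 2 ^ t) = Algebra.trace (ZMod 2) F (g ^ 2 ^ (m - t) * x) := by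
  rw [← trace_pow_two_pow (g * x ^ 2 ^ t) (m - t), mul_pow, pow_two_pow_pow,
    Nat.add_sub_cancel' ht, pow_two_pow_card hF]

theorem trace_eq_zero_of_forall {z : F}
    (h : ∀ y, Algebra.trace (ZMod 2) F (y * z) = 0) : z = 0 := by
  have htr := (traceForm_nondegenerate (ZMod 2) F).1 z
  simp_rw [Algebra.traceForm_apply] at htr
  exact htr fun y => by rw [mul_comm, h]

/-- The quadratic form `x ↦ Tr (g * x ^ (2 ^ t + 1))` and its polar form. -/
theorem trace_mul_pow_add {m t : ℕ} (hF : Fintype.card F = 2 ^ m) (ht : t ≤ m) (g x y : F) :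
    Algebra.trace (ZMod 2) F (g * (x + y) ^ (2 ^ t + 1)) =
      Algebra.trace (ZMod 2) F (g * x ^ (2 ^ t + 1)) +
      Algebra.trace (ZMod 2) F (g * y ^ (2 ^ t + 1)) +
      Algebra.trace (ZMod 2) F (y * (g * x ^ 2 ^ t + (g * x) ^ 2 ^ (m - t))) := by
  have h : g * (x + y) ^ (2 ^ t + 1) = g * x ^ (2 ^ t + 1) + g * y ^ (2 ^ t + 1) +
      (y * (g * x ^ 2 ^ t) + (g * x) * y ^ 2 ^ t) := by
    rw [pow_succ, add_pow_two_pow]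
    ring
  rw [h, map_add, map_add, map_add, trace_mul_pow_two_pow hF ht (g * x) y, mul_add y, map_add,
    mul_comm y (_ ^ _)]

theorem ncard_pow_eq_one {F : Type*} [Field F] [Fintype F] (n : ℕ) :
    {x : F | x ≠ 0 ∧ x ^ n = 1}.ncard = (Fintype.card F - 1).gcd n := by
  have h : {x : F | x ≠ 0 ∧ x ^ n = 1} =
      Units.val '' ((powMonoidHom n : Fˣ →* Fˣ).ker : Set Fˣ) := by
    ext x
    simp only [Set.mem_ofPred_eq, Set.mem_image, SetLike.mem_coe, MonoidHom.mem_ker,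
      powMonoidHom_apply]
    constructor
    · rintro ⟨hx, h⟩
      exact ⟨Units.mk0 x hx, by ext; simpa using h, rfl⟩
    · rintro ⟨u, hu, rfl⟩
      exact ⟨u.ne_zero, by rw [← Units.val_pow_eq_pow_val, hu, Units.val_one]⟩
  have h2 := IsCyclic.card_powMonoidHom_ker Fˣ n
  rw [h, Set.ncard_image_of_injective _ Units.val_injective, ← Nat.card_coe_set_eq]
  refine h2.trans ?_
  rw [Nat.card_units, Nat.card_eq_fintype_card]

/-- The nonzero fixed points are the roots of unity of order dividing `2 ^ t - 1` in a cyclic group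
of order `2 ^ m - 1`, and `gcd (2 ^ m - 1) (2 ^ t - 1) = 2 ^ gcd m t - 1`. -/
theorem ncard_pow_two_pow_eq {F : Type*} [Field F] [Fintype F] {m : ℕ}
    (hF : Fintype.card F = 2 ^ m) (t : ℕ) :
    {x : F | x ^ 2 ^ t = x}.ncard = 2 ^ m.gcd t := by
  have h : {x : F | x ^ 2 ^ t = x} = insert 0 {x : F | x ≠ 0 ∧ x ^ (2 ^ t - 1) = 1} := by
    ext x
    have h1 : 2 ^ t = (2 ^ t - 1) + 1 := by have := Nat.one_le_two_pow (n := t); omega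
    rcases eq_or_ne x 0 with rfl | hx
    · simp
    · simp only [Set.mem_ofPred_eq, Set.mem_insert_iff, hx, ne_eq, not_false_eq_true, true_and,
        false_or]
      conv_lhs => rw [h1, pow_succ]
      exact mul_eq_right₀ hx
  rw [h, Set.ncard_insert_of_notMem (by simp), ncard_pow_eq_one, hF,
    Nat.pow_sub_one_gcd_pow_sub_one]
  exact Nat.sub_add_cancel Nat.one_le_two_pow

theorem natCard_subfieldTwoPow {m : ℕ} (hF : Fintype.card F = 2 ^ m) (t : ℕ) :
    Nat.card (subfieldTwoPow F t) = 2 ^ m.gcd t := by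
  rw [← ncard_pow_two_pow_eq hF t, ← Nat.card_coe_set_eq]
  rfl

end FiniteFieldCharTwo

/-! ### The relative trace onto the subfield with `2 ^ s` elements. -/

section RelTrace

variable {F : Type*} [Field F] [Fintype F] [Algebra (ZMod 2) F] (s : ℕ)
  (hF : Fintype.card F = 2 ^ (2 * s))

/-- The relative trace `z ↦ z + z ^ (2 ^ s)` onto the subfield with `2 ^ s` elements. -/
def relTrace : F →+ subfieldTwoPow F s where
  toFun z := ⟨z + z ^ 2 ^ s, by
    change (z + z ^ 2 ^ s) ^ 2 ^ s = z + z ^ 2 ^ s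
    rw [add_pow_two_pow, pow_two_pow_pow, ← two_mul, pow_two_pow_card hF, add_comm]⟩
  map_zero' := by ext; simp
  map_add' x y := by
    ext
    simp only [add_pow_two_pow, AddMemClass.coe_add]
    ring

theorem coe_relTrace (z : F) : (relTrace s hF z : F) = z + z ^ 2 ^ s := rfl

theorem pow_coe_subfieldTwoPow {F : Type*} [Field F] [Algebra (ZMod 2) F] (s : ℕ)
    (a : subfieldTwoPow F s) : (a : F) ^ 2 ^ s = a := a.2

theorem natCard_subfieldTwoPow_half (s : ℕ) (hF : Fintype.card F = 2 ^ (2 * s)) :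
    Nat.card (subfieldTwoPow F s) = 2 ^ s := by
  rw [natCard_subfieldTwoPow hF, Nat.gcd_mul_left_left]

theorem natCard_ker_relTrace : Nat.card (relTrace s hF).ker = 2 ^ s := by
  have := charP_two_of_algebra F
  rw [← natCard_subfieldTwoPow_half s hF]
  refine Nat.card_congr (Equiv.subtypeEquivRight fun z => ?_)
  change relTrace s hF z = 0 ↔ z ^ 2 ^ s = z
  rw [Subtype.ext_iff, coe_relTrace, ZeroMemClass.coe_zero, CharTwo.add_eq_zero, eq_comm]

/-- The kernel is the subfield itself, so the image has `2 ^ (2 * s) / 2 ^ s` elements, which is the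
size of the target. -/
theorem relTrace_surjective : Function.Surjective (relTrace s hF) := by
  have h1 := (relTrace s hF).ker.card_mul_index
  rw [AddSubgroup.index_ker, natCard_ker_relTrace, Nat.card_eq_fintype_card (α := F), hF, two_mul,
    pow_add] at h1
  have h2 := Nat.eq_of_mul_eq_mul_left (by positivity) h1
  rw [← AddMonoidHom.range_eq_top]
  apply AddSubgroup.eq_top_of_card_eq
  rw [h2, natCard_subfieldTwoPow_half s hF]

/-- Transitivity of the trace: the `2 * s` Frobenius conjugates are split into two halves, the
second being the image of the first under `z ↦ z ^ 2 ^ s`. -/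
theorem trace_relTrace (z : F) :
    Algebra.trace (ZMod 2) (subfieldTwoPow F s) (relTrace s hF z) =
      Algebra.trace (ZMod 2) F z := by
  apply (algebraMap (ZMod 2) F).injective
  have hfin : Module.finrank (ZMod 2) F = 2 * s := by
    have := Module.card_eq_pow_finrank (K := ZMod 2) (V := F)
    rw [hF, ZMod.card] at this
    exact (Nat.pow_right_injective le_rfl this).symm
  have hfinE : Module.finrank (ZMod 2) (subfieldTwoPow F s) = s := by
    have := Module.natCard_eq_pow_finrank (K := ZMod 2) (V := subfieldTwoPow F s)
    rw [natCard_subfieldTwoPow_half s hF, Nat.card_eq_fintype_card, ZMod.card] at this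
    exact (Nat.pow_right_injective le_rfl this).symm
  rw [FiniteField.algebraMap_trace_eq_sum_pow, hfin,
    IsScalarTower.algebraMap_apply (ZMod 2) (subfieldTwoPow F s) F,
    FiniteField.algebraMap_trace_eq_sum_pow, hfinE, map_sum, two_mul, Finset.sum_range_add,
    ← Finset.sum_add_distrib]
  refine Finset.sum_congr rfl fun i _ => ?_
  rw [map_pow, Nat.card_eq_fintype_card, ZMod.card]
  change (z + z ^ 2 ^ s) ^ 2 ^ i = _
  rw [add_pow_two_pow, pow_two_pow_pow]

end RelTrace

/-! ### Codewords as quadratic functions, and affine invariance of the code. -/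

section KasamiWords

variable {F : Type*} [Field F] [Fintype F] [Algebra (ZMod 2) F]

/-- The word `(Tr (e * x ^ (2 ^ s + 1) + b * x ^ (2 ^ l + 1) + c * x) + h)_{x ∈ F}`. -/
noncomputable def traceWord (s l : ℕ) (e b c : F) (h : ZMod 2) (x : F) : ZMod 2 :=
  Algebra.trace (ZMod 2) F (e * x ^ (2 ^ s + 1)) + Algebra.trace (ZMod 2) F (b * x ^ (2 ^ l + 1))
    + Algebra.trace (ZMod 2) F (c * x) + h

/-- The codeword of the Kasami code with parameters `a, b, c, h`. -/
noncomputable def kasamiWord (s l : ℕ) (hF : Fintype.card F = 2 ^ (2 * s))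
    (a : subfieldTwoPow F s) (b c : F) (h : ZMod 2) (x : F) : ZMod 2 :=
  Algebra.trace (ZMod 2) (subfieldTwoPow F s) (a * powToSubfield s hF x) +
      Algebra.trace (ZMod 2) F (b * x ^ (2 ^ l + 1) + c * x) + h

theorem mem_kasamiCode {s l : ℕ} {hF : Fintype.card F = 2 ^ (2 * s)} {w : F → ZMod 2} :
    w ∈ kasamiCode F s l hF ↔ ∃ a b c h, w = kasamiWord s l hF a b c h := Iff.rfl

theorem kasamiWord_relTrace (s l : ℕ) (hF : Fintype.card F = 2 ^ (2 * s))
    (e b c : F) (h : ZMod 2) :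
    kasamiWord s l hF (relTrace s hF e) b c h = traceWord s l e b c h := by
  funext x
  have : relTrace s hF e * powToSubfield s hF x = relTrace s hF (e * x ^ (2 ^ s + 1)) := by
    ext
    have h1 : (x ^ (2 ^ s + 1)) ^ 2 ^ s = x ^ (2 ^ s + 1) := (powToSubfield s hF x).2
    rw [coe_relTrace, mul_pow, h1, MulMemClass.coe_mul, coe_relTrace, add_mul]
    rfl
  rw [kasamiWord, traceWord, this, trace_relTrace, map_add]
  ring

/-- Writing `a` as a relative trace puts both quadratic terms under the absolute trace, so that one
computation of the polar form serves both. -/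
theorem mem_kasamiCode_iff_traceWord {s l : ℕ} {hF : Fintype.card F = 2 ^ (2 * s)}
    {w : F → ZMod 2} :
    w ∈ kasamiCode F s l hF ↔ ∃ e b c h, w = traceWord s l e b c h := by
  rw [mem_kasamiCode]
  constructor
  · rintro ⟨a, b, c, h, rfl⟩
    obtain ⟨e, rfl⟩ := relTrace_surjective s hF a
    exact ⟨e, b, c, h, kasamiWord_relTrace s l hF e b c h⟩
  · rintro ⟨e, b, c, h, rfl⟩
    exact ⟨_, b, c, h, (kasamiWord_relTrace s l hF e b c h).symm⟩

/-- The linear map attached to the polar form of the quadratic part of the words. -/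
def polarMap (s l : ℕ) (a b x : F) : F :=
  a * x ^ 2 ^ s + (b * x ^ 2 ^ l + (b * x) ^ 2 ^ (2 * s - l))

theorem traceWord_add {s l : ℕ} (hF : Fintype.card F = 2 ^ (2 * s)) (hl : l ≤ 2 * s)
    (e b c : F) (h : ZMod 2) (x y : F) :
    traceWord s l e b c h (x + y) = traceWord s l e b c h x + traceWord s l e b c h y + h +
      Algebra.trace (ZMod 2) F (y * polarMap s l (relTrace s hF e : F) b x) := by
  have h2 : (2 : ZMod 2) = 0 := rfl
  rw [traceWord, trace_mul_pow_add hF (by omega) e, trace_mul_pow_add hF hl b, traceWord,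
    traceWord, mul_add c, map_add, polarMap, coe_relTrace, mul_add y ((e + e ^ 2 ^ s) * x ^ 2 ^ s),
    map_add, show 2 * s - s = s by omega, mul_pow e x, add_mul]
  linear_combination -h * h2

theorem kasamiWord_add {s l : ℕ} (hF : Fintype.card F = 2 ^ (2 * s)) (hl : l ≤ 2 * s)
    (a : subfieldTwoPow F s) (b c : F) (h : ZMod 2) (x y : F) :
    kasamiWord s l hF a b c h (x + y) =
      kasamiWord s l hF a b c h x + kasamiWord s l hF a b c h y + h +
      Algebra.trace (ZMod 2) F (y * polarMap s l (a : F) b x) := by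
  obtain ⟨e, rfl⟩ := relTrace_surjective s hF a
  rw [kasamiWord_relTrace, traceWord_add hF hl]

theorem kasamiWord_zero_right {s l : ℕ} (hF : Fintype.card F = 2 ^ (2 * s))
    (a : subfieldTwoPow F s) (b c : F) (h : ZMod 2) : kasamiWord s l hF a b c h 0 = h := by
  obtain ⟨e, rfl⟩ := relTrace_surjective s hF a
  simp [kasamiWord_relTrace, traceWord]

theorem kasamiWord_eq_add {s l : ℕ} (hF : Fintype.card F = 2 ^ (2 * s))
    (a : subfieldTwoPow F s) (b c : F) (h : ZMod 2) (x : F) :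
    kasamiWord s l hF a b c h x =
      kasamiWord s l hF a b 0 0 x + Algebra.trace (ZMod 2) F (c * x) + h := by
  simp only [kasamiWord, map_add, zero_mul, map_zero]
  ring

/-- The quadratic coefficients are only rescaled; the translation by `v` adds the polar form against
`v`, which is absorbed into `c`, and a constant, absorbed into `h`. -/
theorem traceWord_comp_affine {s l : ℕ} (hF : Fintype.card F = 2 ^ (2 * s)) (hl : l ≤ 2 * s)
    (e b c : F) (h : ZMod 2) (u v : F) :
    ∃ e' b' c' h', (fun x => traceWord s l e b c h (u * x + v)) = traceWord s l e' b' c' h' := by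
  refine ⟨e * u ^ (2 ^ s + 1), b * u ^ (2 ^ l + 1),
    c * u + u * polarMap s l (relTrace s hF e : F) b v, traceWord s l e b c h v, ?_⟩
  funext x
  have h2 : (2 : ZMod 2) = 0 := rfl
  have h1 : u * x * polarMap s l (relTrace s hF e : F) b v =
    u * polarMap s l (relTrace s hF e : F) b v * x := by ring
  rw [add_comm, traceWord_add hF hl, h1]
  simp only [traceWord, mul_pow, add_mul, map_add, mul_assoc]
  linear_combination h * h2

/-- All exponents are below `q - 1`, so the power sums over `F` vanish. The bound `2 ≤ s` matters:
for `q = 4` the exponent `3` would equal `q - 1`. -/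
theorem sum_traceWord {s l : ℕ} (hs : 2 ≤ s) (hl : l ≤ 2 * s - 1)
    (hF : Fintype.card F = 2 ^ (2 * s)) (e b c : F) (h : ZMod 2) :
    ∑ x, traceWord s l e b c h x = 0 := by
  have key : ∀ t, t ≤ 2 * s - 1 → ∀ g : F,
      ∑ x : F, Algebra.trace (ZMod 2) F (g * x ^ (2 ^ t + 1)) = 0 := by
    intro t ht g
    rw [← map_sum, ← Finset.mul_sum, FiniteField.sum_pow_lt_card_sub_one, mul_zero, map_zero]
    have h1 : 2 ^ t ≤ 2 ^ (2 * s - 1) := Nat.pow_le_pow_right (by norm_num) ht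
    have h2 : 2 ^ (2 * s) = 2 * 2 ^ (2 * s - 1) := by rw [← pow_succ']; congr 1; omega
    have h3 : 2 ^ 3 ≤ 2 ^ (2 * s - 1) := Nat.pow_le_pow_right (by norm_num) (by omega)
    omega
  have h4 : ∑ x : F, Algebra.trace (ZMod 2) F (c * x) = 0 := by
    have h1 : 2 ^ 2 ≤ 2 ^ (2 * s) := Nat.pow_le_pow_right (by norm_num) (by omega)
    have h2 := FiniteField.sum_pow_lt_card_sub_one F 1 (by omega)
    simp only [pow_one] at h2
    rw [← map_sum, ← Finset.mul_sum, h2, mul_zero, map_zero]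
  simp only [traceWord, Finset.sum_add_distrib]
  rw [key s (by omega), key l hl, h4, Finset.sum_const, Finset.card_univ, hF, nsmul_eq_mul,
    Nat.cast_pow]
  have h5 : ((2 : ℕ) : ZMod 2) = 0 := rfl
  rw [h5, zero_pow (by omega)]
  ring

theorem affinePerms_subset_permAut_kasamiCode {s l : ℕ} (hF : Fintype.card F = 2 ^ (2 * s))
    (hl : l ≤ 2 * s) : affinePerms F ⊆ permAut (kasamiCode F s l hF) := by
  have key : ∀ u v : F, ∀ w ∈ kasamiCode F s l hF,
      (fun x => w (u * x + v)) ∈ kasamiCode F s l hF := by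
    intro u v w hw
    obtain ⟨e, b, c, h, rfl⟩ := mem_kasamiCode_iff_traceWord.mp hw
    exact mem_kasamiCode_iff_traceWord.mpr (traceWord_comp_affine hF hl e b c h u v)
  rintro σ ⟨u, v, hu, hσ⟩ w
  simp only [hσ]
  refine ⟨fun h => ?_, key u v w⟩
  convert key u⁻¹ (-u⁻¹ * v) _ h using 2 with x
  field_simp
  ring_nf

theorem isAffineInvariant_kasamiCode {s l : ℕ} (hs : 2 ≤ s) (hl : l ≤ 2 * s - 1)
    (hF : Fintype.card F = 2 ^ (2 * s)) : IsAffineInvariant (kasamiCode F s l hF) := by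
  classical
  have haff := affinePerms_subset_permAut_kasamiCode (l := l) hF (by omega)
  have hsum : ∀ w ∈ kasamiCode F s l hF, ∑ x, w x = 0 := by
    intro w hw
    obtain ⟨e, b, c, h, rfl⟩ := mem_kasamiCode_iff_traceWord.mp hw
    exact sum_traceWord hs hl hF e b c h
  refine ⟨⟨(kasamiCode F s l hF).map (LinearMap.funLeft (ZMod 2) (ZMod 2) Units.val), ?_, ?_⟩,
    haff⟩
  · rintro u _ ⟨w, hw, rfl⟩
    refine ⟨fun x => w (u * x), ?_, rfl⟩
    have := (haff (affinePerm_mem (u : F) 0 u.ne_zero) w).mpr hw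
    simpa using this
  · intro w
    refine ⟨fun hw => ⟨⟨w, hw, rfl⟩, hsum w hw⟩, ?_⟩
    rintro ⟨⟨w', hw', h⟩, h0⟩
    have hu : ∀ x : F, x ≠ 0 → w' x = w x := fun x hx => congrFun h (Units.mk0 x hx)
    suffices w' = w from this ▸ hw'
    funext x
    rcases eq_or_ne x 0 with rfl | hx
    -- The coordinate at `0` is determined by the others through the parity check.
    · have h1 := hsum w' hw'
      rw [← Finset.add_sum_erase _ _ (Finset.mem_univ 0)] at h0 h1
      rw [Finset.sum_congr rfl fun x hx => hu x (Finset.ne_of_mem_erase hx)] at h1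
      exact add_right_cancel (h1.trans h0.symm)
    · exact hu x hx

end KasamiWords

/-! ### Character sums of the words and their radicals. -/

section CharacterSums

/-- The nontrivial character of `ZMod 2`, with integer values. -/
def binarySign (t : ZMod 2) : ℤ := if t = 0 then 1 else -1

theorem binarySign_add (t u : ZMod 2) : binarySign (t + u) = binarySign t * binarySign u := by
  revert t u
  decide

@[simp] theorem binarySign_zero : binarySign 0 = 1 := rfl

@[simp] theorem binarySign_one : binarySign 1 = -1 := rfl

/-- The character sum of a binary word. -/
def walshSum {P : Type*} [Fintype P] (w : P → ZMod 2) : ℤ := ∑ x, binarySign (w x)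

theorem walshSum_eq_card_sub {P : Type*} [Fintype P] (w : P → ZMod 2) :
    walshSum w = Fintype.card P - 2 * hammingNorm w := by
  have h : ∀ t : ZMod 2, binarySign t = 1 - 2 * if t ≠ 0 then 1 else 0 := by decide
  simp only [walshSum, h, Finset.sum_sub_distrib, ← Finset.mul_sum, hammingNorm,
    Finset.card_filter]
  simp

variable {F : Type*} [Field F] [Fintype F] [Algebra (ZMod 2) F]

/-- The additive character `x ↦ (-1) ^ Tr x`. -/
noncomputable def traceChar (F : Type*) [Field F] [Algebra (ZMod 2) F] : AddChar F ℤ where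
  toFun x := binarySign (Algebra.trace (ZMod 2) F x)
  map_zero_eq_one' := by simp
  map_add_eq_mul' x y := by rw [map_add, binarySign_add]

theorem traceChar_isPrimitive : (traceChar F).IsPrimitive := by
  refine AddChar.IsPrimitive.of_ne_one fun h => one_ne_zero (α := F) ?_
  refine trace_eq_zero_of_forall fun y => ?_
  have h1 : binarySign (Algebra.trace (ZMod 2) F y) = 1 := DFunLike.congr_fun h y
  have h2 : ∀ t, binarySign t = 1 → t = 0 := by decide
  rw [mul_one, h2 _ h1]

theorem sum_binarySign_trace_mul [DecidableEq F] (z : F) :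
    ∑ x, binarySign (Algebra.trace (ZMod 2) F (x * z)) = if z = 0 then Fintype.card F else 0 := by
  have := AddChar.sum_mulShift z (traceChar_isPrimitive (F := F))
  push_cast at this ⊢
  exact this

/-- The radical of the quadratic part of the words of the Kasami code. -/
def polarRadical (s l : ℕ) (a b : F) : AddSubgroup F where
  carrier := {x | polarMap s l a b x = 0}
  zero_mem' := by simp [polarMap]
  add_mem' := by
    intro x y hx hy
    simp only [Set.mem_ofPred_eq, polarMap, mul_add, add_pow_two_pow] at *
    linear_combination hx + hy
  neg_mem' := by
    intro x hx
    have := charP_two_of_algebra F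
    simpa [CharTwo.neg_eq] using hx

theorem mem_polarRadical {F : Type*} [Field F] [Algebra (ZMod 2) F] {s l : ℕ} {a b x : F} :
    x ∈ polarRadical s l a b ↔ polarMap s l a b x = 0 := Iff.rfl

/-- The words are affine on the radical. -/
noncomputable def radicalChar {s l : ℕ} (hF : Fintype.card F = 2 ^ (2 * s)) (hl : l ≤ 2 * s)
    (a : subfieldTwoPow F s) (b c : F) : AddChar (polarRadical s l (a : F) b) ℤ where
  toFun x := binarySign (kasamiWord s l hF a b c 0 x)
  map_zero_eq_one' := by simp [kasamiWord_zero_right]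
  map_add_eq_mul' x y := by
    rw [AddSubgroup.coe_add, kasamiWord_add hF hl, mem_polarRadical.mp x.2, mul_zero, map_zero,
      add_zero, add_zero, binarySign_add]

theorem walshSum_sq {s l : ℕ} (hF : Fintype.card F = 2 ^ (2 * s)) (hl : l ≤ 2 * s)
    (a : subfieldTwoPow F s) (b c : F) [Fintype (polarRadical s l (a : F) b)] :
    walshSum (kasamiWord s l hF a b c 0) ^ 2 =
      Fintype.card F * ∑ z, radicalChar hF hl a b c z := by
  classical
  have h1 : walshSum (kasamiWord s l hF a b c 0) ^ 2 =
      ∑ z : F, ∑ x : F, binarySign (kasamiWord s l hF a b c 0 z) *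
        binarySign (Algebra.trace (ZMod 2) F (x * polarMap s l (a : F) b z)) := by
    rw [sq, walshSum, Finset.sum_mul_sum]
    refine Eq.trans ?_ Finset.sum_comm
    refine Finset.sum_congr rfl fun x _ => ?_
    -- With the second variable written as `z + x`, the product of the two signs becomes the sign at
    -- `z` times a character in `x`. Summing over `x` then leaves only the `z` in the radical.
    rw [← Equiv.sum_comp (Equiv.addRight x)]
    refine Finset.sum_congr rfl fun z _ => ?_
    rw [Equiv.coe_addRight, kasamiWord_add hF hl, ← binarySign_add, ← binarySign_add]
    congr 1
    have h2 : (2 : ZMod 2) = 0 := rfl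
    linear_combination kasamiWord s l hF a b c 0 x * h2
  rw [h1]
  simp_rw [← Finset.mul_sum, sum_binarySign_trace_mul]
  push_cast
  simp_rw [mul_ite, mul_zero]
  rw [← Finset.sum_filter, mul_comm, Finset.sum_mul]
  symm
  refine Finset.sum_bij (fun z _ => (z : F)) ?_ ?_ ?_ ?_
  · intro z _
    simpa using mem_polarRadical.mp z.2
  · intro z _ z' _ h
    exact Subtype.ext h
  · intro z hz
    exact ⟨⟨z, mem_polarRadical.mpr (by simpa using hz)⟩, Finset.mem_univ _, rfl⟩
  · intro z _
    rfl

/-- On the radical the word is additive, so its sign is a character there, and a character sums to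
`0` or to the order of the group. -/
theorem walshSum_sq_eq_or {s l : ℕ} (hF : Fintype.card F = 2 ^ (2 * s)) (hl : l ≤ 2 * s)
    (a : subfieldTwoPow F s) (b c : F) :
    walshSum (kasamiWord s l hF a b c 0) = 0 ∨
      walshSum (kasamiWord s l hF a b c 0) ^ 2 =
        Fintype.card F * Nat.card (polarRadical s l (a : F) b) := by
  classical
  have := Fintype.ofFinite (polarRadical s l (a : F) b)
  have h := walshSum_sq hF hl a b c
  by_cases hψ : radicalChar hF hl a b c = 1
  · right
    rw [h, AddChar.sum_eq_card_of_eq_one hψ, Nat.card_eq_fintype_card]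
  · left
    rw [AddChar.sum_eq_zero_of_ne_one hψ, mul_zero] at h
    exact pow_eq_zero_iff two_ne_zero |>.mp h

theorem sum_walshSum_sq {s l : ℕ} (hF : Fintype.card F = 2 ^ (2 * s)) (hl : l ≤ 2 * s)
    (a : subfieldTwoPow F s) (b : F) :
    ∑ c, walshSum (kasamiWord s l hF a b c 0) ^ 2 = (Fintype.card F : ℤ) ^ 2 := by
  classical
  have := Fintype.ofFinite (polarRadical s l (a : F) b)
  simp_rw [walshSum_sq hF hl a b, ← Finset.mul_sum]
  rw [Finset.sum_comm]
  have h1 : ∀ z : polarRadical s l (a : F) b, ∑ c, radicalChar hF hl a b c z =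
      if z = 0 then (Fintype.card F : ℤ) else 0 := by
    intro z
    have h2 : ∀ c, radicalChar hF hl a b c z = binarySign (kasamiWord s l hF a b 0 0 z) *
        binarySign (Algebra.trace (ZMod 2) F (c * z)) := by
      intro c
      change binarySign (kasamiWord s l hF a b c 0 z) = _
      rw [kasamiWord_eq_add, add_zero, binarySign_add]
    simp_rw [h2, ← Finset.mul_sum, sum_binarySign_trace_mul]
    by_cases hz : z = 0
    · simp [hz, kasamiWord_zero_right]
    · have : (z : F) ≠ 0 := fun h => hz (Subtype.ext h)
      simp [hz, this]
  simp_rw [h1]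
  rw [Finset.sum_ite_eq' Finset.univ (0 : polarRadical s l (a : F) b), if_pos (Finset.mem_univ _),
    sq]

/-- Parseval: the squares add up to `q ^ 2` over all `c`, and each nonzero one equals `q * |R|`. -/
theorem card_walshSum_ne_zero {s l : ℕ} (hF : Fintype.card F = 2 ^ (2 * s)) (hl : l ≤ 2 * s)
    (a : subfieldTwoPow F s) (b : F) :
    (Finset.univ.filter fun c => walshSum (kasamiWord s l hF a b c 0) ≠ 0).card *
      Nat.card (polarRadical s l (a : F) b) = Fintype.card F := by
  have h1 := sum_walshSum_sq hF hl a b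
  have h2 : ∀ c, walshSum (kasamiWord s l hF a b c 0) ^ 2 =
      if walshSum (kasamiWord s l hF a b c 0) ≠ 0 then
        (Fintype.card F * Nat.card (polarRadical s l (a : F) b) : ℤ) else 0 := by
    intro c
    rcases walshSum_sq_eq_or hF hl a b c with h | h
    · simp [h]
    · split_ifs with h0
      · exact h
      · rw [not_not] at h0
        simp [h0]
  rw [Finset.sum_congr rfl fun c _ => h2 c, ← Finset.sum_filter, Finset.sum_const,
    nsmul_eq_mul] at h1
  have hq : (Fintype.card F : ℤ) ≠ 0 := by exact_mod_cast Fintype.card_ne_zero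
  have h3 : (((Finset.univ.filter fun c => walshSum (kasamiWord s l hF a b c 0) ≠ 0).card *
      Nat.card (polarRadical s l (a : F) b) : ℕ) : ℤ) = Fintype.card F := by
    refine mul_left_cancel₀ hq ?_
    push_cast
    linear_combination h1
  exact_mod_cast h3

theorem walshSum_kasamiWord_one {s l : ℕ} (hF : Fintype.card F = 2 ^ (2 * s))
    (a : subfieldTwoPow F s) (b c : F) :
    walshSum (kasamiWord s l hF a b c 1) = -walshSum (kasamiWord s l hF a b c 0) := by
  simp only [walshSum, ← Finset.sum_neg_distrib]
  refine Finset.sum_congr rfl fun x _ => ?_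
  rw [kasamiWord_eq_add, binarySign_add, kasamiWord_eq_add hF a b c 0, add_zero]
  simp

/-- The number of words with given quadratic part and given character sum. -/
noncomputable def walshCount (s l : ℕ) (hF : Fintype.card F = 2 ^ (2 * s))
    (a : subfieldTwoPow F s) (b : F) (T : ℤ) : ℕ :=
  (Finset.univ.filter fun p : F × ZMod 2 => walshSum (kasamiWord s l hF a b p.1 p.2) = T).card

theorem walshCount_eq_sum (s l : ℕ) (hF : Fintype.card F = 2 ^ (2 * s))
    (a : subfieldTwoPow F s) (b : F) (T : ℤ) :
    walshCount s l hF a b T = ∑ c : F,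
      ((if walshSum (kasamiWord s l hF a b c 0) = T then 1 else 0) +
        if -walshSum (kasamiWord s l hF a b c 0) = T then 1 else 0) := by
  rw [walshCount, Finset.card_filter, Fintype.sum_prod_type]
  refine Finset.sum_congr rfl fun c _ => ?_
  rw [← walshSum_kasamiWord_one]
  exact Fin.sum_univ_two _

/-- Changing `h` negates the character sum, so each `c` with a nonzero sum yields `T` for exactly
one of the two `h`. The count is therefore the same for `T` and `-T`. -/
theorem walshCount_mul_card_radical {s l : ℕ} (hF : Fintype.card F = 2 ^ (2 * s))
    (hl : l ≤ 2 * s) (a : subfieldTwoPow F s) (b : F) {T : ℤ} (hT : T ≠ 0)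
    (hT2 : T ^ 2 = Fintype.card F * Nat.card (polarRadical s l (a : F) b)) :
    walshCount s l hF a b T * Nat.card (polarRadical s l (a : F) b) = Fintype.card F := by
  rw [← card_walshSum_ne_zero hF hl a b, walshCount_eq_sum, Finset.card_filter]
  congr 1
  refine Finset.sum_congr rfl fun c _ => ?_
  rcases walshSum_sq_eq_or hF hl a b c with h | h
  · simp [h, hT.symm]
  · rw [← hT2, sq_eq_sq_iff_eq_or_eq_neg] at h
    rcases h with h | h <;> simp [h, hT, neg_eq_self]

theorem walshCount_zero {s l : ℕ} (hF : Fintype.card F = 2 ^ (2 * s))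
    (hl : l ≤ 2 * s) (a : subfieldTwoPow F s) (b : F) :
    walshCount s l hF a b 0 * Nat.card (polarRadical s l (a : F) b) + 2 * Fintype.card F =
      2 * Fintype.card F * Nat.card (polarRadical s l (a : F) b) := by
  have h1 : walshCount s l hF a b 0 +
      2 * (Finset.univ.filter fun c => walshSum (kasamiWord s l hF a b c 0) ≠ 0).card =
      2 * Fintype.card F := by
    rw [walshCount_eq_sum, Finset.card_filter, Finset.mul_sum, ← Finset.sum_add_distrib]
    have : ∀ c : F, ((if walshSum (kasamiWord s l hF a b c 0) = 0 then 1 else 0) +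
        if -walshSum (kasamiWord s l hF a b c 0) = 0 then 1 else 0) +
        2 * (if walshSum (kasamiWord s l hF a b c 0) ≠ 0 then 1 else 0) = 2 := by
      intro c
      by_cases h : walshSum (kasamiWord s l hF a b c 0) = 0 <;> simp [h]
    rw [Finset.sum_congr rfl fun c _ => this c]
    simp [mul_comm]
  have h2 := card_walshSum_ne_zero hF hl a b
  rw [← h1, add_mul, mul_assoc 2 _ (Nat.card _), h2, h1]

theorem walshCount_eq_zero {s l : ℕ} (hF : Fintype.card F = 2 ^ (2 * s))
    (hl : l ≤ 2 * s) (a : subfieldTwoPow F s) (b : F) {T : ℤ} (hT : T ≠ 0)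
    (hT2 : T ^ 2 ≠ Fintype.card F * Nat.card (polarRadical s l (a : F) b)) :
    walshCount s l hF a b T = 0 := by
  rw [walshCount_eq_sum]
  refine Finset.sum_eq_zero fun c _ => ?_
  rcases walshSum_sq_eq_or hF hl a b c with h | h
  · simp [h, hT.symm]
  · rw [if_neg fun h0 => hT2 (by rw [← h0, h]),
      if_neg fun h0 => hT2 (by rw [← h0, neg_sq, h]), add_zero]

noncomputable instance (s : ℕ) : Fintype (subfieldTwoPow F s) := Fintype.ofFinite _

/-- A vanishing word has vanishing polar form, which kills `a` and `b` by `hrad`; evaluation at `0`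
kills `h`, and nondegeneracy of the trace kills `c`. Counting words thus becomes counting
parameters. -/
theorem kasamiWord_injective {s l : ℕ} (hF : Fintype.card F = 2 ^ (2 * s)) (hl : l ≤ 2 * s)
    (hrad : ∀ (a : subfieldTwoPow F s) (b : F), (∀ x, polarMap s l (a : F) b x = 0) →
      a = 0 ∧ b = 0) :
    Function.Injective fun p : (subfieldTwoPow F s × F) × (F × ZMod 2) =>
      kasamiWord s l hF p.1.1 p.1.2 p.2.1 p.2.2 := by
  rintro ⟨⟨a, b⟩, c, h⟩ ⟨⟨a', b'⟩, c', h'⟩ heq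
  have h0 : ∀ x, kasamiWord s l hF (a - a') (b - b') (c - c') (h - h') x = 0 := by
    intro x
    have := congrFun heq x
    simp only at this
    rw [← sub_eq_zero] at this
    rw [← this]
    simp only [kasamiWord, sub_mul, map_add, map_sub]
    ring
  have hh : h - h' = 0 := by simpa [kasamiWord_zero_right] using h0 0
  have hab := hrad (a - a') (b - b') fun x => trace_eq_zero_of_forall fun y => by
    have := kasamiWord_add hF hl (a - a') (b - b') (c - c') (h - h') x y
    rw [h0, h0, h0, hh] at this
    simpa using this.symm
  have hc : c - c' = 0 := trace_eq_zero_of_forall fun y => by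
    have := h0 y
    rw [hab.1, hab.2, hh] at this
    simpa [kasamiWord, mul_comm] using this
  simp only [sub_eq_zero] at hab hc hh
  simp [hab, hc, hh]

theorem ncard_hammingNorm_kasamiCode {s l : ℕ} (hF : Fintype.card F = 2 ^ (2 * s))
    (hl : l ≤ 2 * s)
    (hrad : ∀ (a : subfieldTwoPow F s) (b : F), (∀ x, polarMap s l (a : F) b x = 0) →
      a = 0 ∧ b = 0) (i : ℕ) :
    {w | w ∈ kasamiCode F s l hF ∧ hammingNorm w = i}.ncard =
      ∑ p : subfieldTwoPow F s × F, walshCount s l hF p.1 p.2 (Fintype.card F - 2 * i) := by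
  classical
  have h1 : {w | w ∈ kasamiCode F s l hF ∧ hammingNorm w = i} =
      (fun p : (subfieldTwoPow F s × F) × (F × ZMod 2) =>
        kasamiWord s l hF p.1.1 p.1.2 p.2.1 p.2.2) '' ↑(Finset.univ.filter
          fun p : (subfieldTwoPow F s × F) × (F × ZMod 2) =>
            walshSum (kasamiWord s l hF p.1.1 p.1.2 p.2.1 p.2.2) =
              (Fintype.card F - 2 * i : ℤ)) := by
    ext w
    simp only [Set.mem_ofPred_eq, mem_kasamiCode, Set.mem_image, Finset.coe_filter,
      Finset.mem_univ, true_and, walshSum_eq_card_sub]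
    constructor
    · rintro ⟨⟨a, b, c, h, rfl⟩, hi⟩
      exact ⟨((a, b), (c, h)), by simp only [hi], rfl⟩
    · rintro ⟨⟨⟨a, b⟩, ⟨c, h⟩⟩, hi, rfl⟩
      refine ⟨⟨a, b, c, h, rfl⟩, ?_⟩
      simp only at hi ⊢
      omega
  rw [h1, Set.ncard_image_of_injective _ (kasamiWord_injective hF hl hrad), Set.ncard_coe_finset,
    Finset.card_filter, Fintype.sum_prod_type]
  refine Finset.sum_congr rfl fun p _ => ?_
  rw [walshCount, Finset.card_filter]

end CharacterSums

/-! ### The possible sizes of the radical. -/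

section Radical

variable {F : Type*} [Field F] [Fintype F] [Algebra (ZMod 2) F]

theorem pow_two_pow_of_dvd {M : Type*} [Monoid M] {x : M} {t n : ℕ} (h : x ^ 2 ^ t = x)
    (htn : t ∣ n) : x ^ 2 ^ n = x := by
  obtain ⟨k, rfl⟩ := htn
  induction k with
  | zero => simp
  | succ k ih => rw [mul_add, mul_one, ← pow_two_pow_pow, ih, h]

/-- Raising to the power `2 ^ l` clears the inverse Frobenius power. Since `2 * l` and `2 * (s + l)`
agree modulo `2 * s`, what remains is a polynomial of degree two in the single operator `x ↦ x ^ 2 ^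
(s + l)`. -/
theorem polarMap_eq_zero_iff {s l : ℕ} (hF : Fintype.card F = 2 ^ (2 * s)) (hl : l ≤ 2 * s)
    (a b x : F) : polarMap s l a b x = 0 ↔
      a ^ 2 ^ l * x ^ 2 ^ (s + l) + b ^ 2 ^ l * (x ^ 2 ^ (s + l)) ^ 2 ^ (s + l) + b * x = 0 := by
  have h1 : (x ^ 2 ^ (s + l)) ^ 2 ^ (s + l) = x ^ 2 ^ (l + l) := by
    rw [pow_two_pow_pow, show s + l + (s + l) = 2 * s + (l + l) by ring, ← pow_two_pow_pow,
      pow_two_pow_card hF]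
  have h2 : polarMap s l a b x ^ 2 ^ l =
      a ^ 2 ^ l * x ^ 2 ^ (s + l) + b ^ 2 ^ l * (x ^ 2 ^ (s + l)) ^ 2 ^ (s + l) + b * x := by
    rw [polarMap, add_pow_two_pow, add_pow_two_pow, pow_two_pow_pow, Nat.sub_add_cancel hl,
      pow_two_pow_card hF, mul_pow, mul_pow, pow_two_pow_pow, pow_two_pow_pow, h1, ← add_assoc]
  rw [← h2, pow_eq_zero_iff (by positivity)]

/-- The radical as a vector space over a subfield whose elements are fixed by
`x ↦ x ^ (2 ^ (s + l))`. -/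
def polarRadicalSubmodule {s l t : ℕ} (hF : Fintype.card F = 2 ^ (2 * s)) (hl : l ≤ 2 * s)
    (ht : t ∣ s + l) (a b : F) : Submodule (subfieldTwoPow F t) F where
  carrier := polarRadical s l a b
  zero_mem' := zero_mem _
  add_mem' := add_mem
  smul_mem' := by
    intro c x hx
    have hc : (c : F) ^ 2 ^ (s + l) = c := pow_two_pow_of_dvd c.2 ht
    rw [SetLike.mem_coe, mem_polarRadical, polarMap_eq_zero_iff hF hl] at *
    rw [Algebra.smul_def, show algebraMap (subfieldTwoPow F t) F c = c from rfl, mul_pow, mul_pow,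
      hc, hc]
    linear_combination (c : F) * hx

theorem exists_card_polarRadical_eq_pow {s l t : ℕ} (hF : Fintype.card F = 2 ^ (2 * s))
    (hl : l ≤ 2 * s) (ht : t ∣ s + l) (hts : t ∣ 2 * s) (a b : F) :
    ∃ j, Nat.card (polarRadical s l a b) = (2 ^ t) ^ j := by
  have := Module.natCard_eq_pow_finrank (K := subfieldTwoPow F t)
    (V := polarRadicalSubmodule hF hl ht a b)
  rw [natCard_subfieldTwoPow hF, Nat.gcd_eq_right hts] at this
  exact ⟨_, this⟩

/-- The shift `x₁` allows the bound to be applied to the fibres of an additive map; `x₁ = 0` serves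
for its image. -/
theorem ncard_le_of_forall_div_fixed {F : Type*} [Field F] [Fintype F] {m t : ℕ}
    (hF : Fintype.card F = 2 ^ m) (S : Set F) (x₁ x₀ : F)
    (hx₀ : x₀ ≠ 0) (h : ∀ x ∈ S, ((x - x₁) / x₀) ^ 2 ^ t = (x - x₁) / x₀) :
    S.ncard ≤ 2 ^ m.gcd t := by
  rw [← ncard_pow_two_pow_eq hF t]
  refine Set.ncard_le_ncard_of_injOn (fun x => (x - x₁) / x₀) h ?_ (Set.toFinite _)
  intro x _ y _ hxy
  simpa [div_left_inj' hx₀] using hxy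

/-- A second-order equation in `σ` has a solution space of dimension at most two over the fixed
field of `σ`. The proof uses the analogue of the Wronskian against a fixed nonzero solution `x₀`:
its values and its fibres are each at most a line over that field. -/
theorem card_polarRadical_le {s l : ℕ} (hF : Fintype.card F = 2 ^ (2 * s)) (hl : l ≤ 2 * s)
    {a b : F} (hab : ¬ (a = 0 ∧ b = 0)) :
    Nat.card (polarRadical s l a b) ≤ (2 ^ (2 * s).gcd (s + l)) ^ 2 := by
  classical
  have := charP_two_of_algebra F
  by_cases hex : ∃ x₀ ∈ polarRadical s l a b, x₀ ≠ 0
  swap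
  · push Not at hex
    have : polarRadical s l a b = ⊥ := (AddSubgroup.eq_bot_iff_forall _).mpr hex
    rw [this, AddSubgroup.card_bot]
    exact Nat.one_le_pow _ _ (by positivity)
  obtain ⟨x₀, hx₀, hx₀0⟩ := hex
  rw [mem_polarRadical, polarMap_eq_zero_iff hF hl] at hx₀
  have hb : b ≠ 0 := by
    rintro rfl
    refine hab ⟨?_, rfl⟩
    simpa [hx₀0] using hx₀
  set W : F → F := fun x => x₀ * x ^ 2 ^ (s + l) + x * x₀ ^ 2 ^ (s + l) with hW
  have hWadd : ∀ x y, W (x - y) = W x - W y := by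
    intro x y
    simp only [hW, CharTwo.sub_eq_add, add_pow_two_pow]
    ring
  -- Eliminating the middle term between the equations for `x` and `x₀` gives a first-order equation
  -- for `W x`, so quotients of nonzero values of `W` are fixed by `σ`.
  have hWrad : ∀ x ∈ polarRadical s l a b,
      b ^ 2 ^ l * W x ^ 2 ^ (s + l) = b * W x := by
    intro x hx
    rw [mem_polarRadical, polarMap_eq_zero_iff hF hl] at hx
    simp only [hW, add_pow_two_pow, mul_pow]
    linear_combination x₀ ^ 2 ^ (s + l) * hx + x ^ 2 ^ (s + l) * hx₀ -
      (a ^ 2 ^ l * x ^ 2 ^ (s + l) * x₀ ^ 2 ^ (s + l) + b * x * x₀ ^ 2 ^ (s + l) +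
        b * x₀ * x ^ 2 ^ (s + l)) * CharTwo.two_eq_zero (R := F)
  set R : Finset F := Finset.univ.filter fun x => x ∈ polarRadical s l a b with hR
  have hcardR : Nat.card (polarRadical s l a b) = R.card := by
    rw [Nat.card_eq_fintype_card, Fintype.card_subtype]
  have himage : (R.image W).card ≤ 2 ^ (2 * s).gcd (s + l) := by
    by_cases h0 : ∃ w₀ ∈ R.image W, w₀ ≠ 0
    · obtain ⟨w₀, hw₀, hw₀0⟩ := h0
      rw [← Set.ncard_coe_finset]
      refine ncard_le_of_forall_div_fixed hF _ 0 w₀ hw₀0 fun w hw => ?_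
      obtain ⟨x, hx, rfl⟩ := Finset.mem_image.mp (Finset.mem_coe.mp hw)
      obtain ⟨y, hy, rfl⟩ := Finset.mem_image.mp hw₀
      have h1 := hWrad x (by simpa [hR] using hx)
      have h2 := hWrad y (by simpa [hR] using hy)
      have h3 : W y ^ 2 ^ (s + l) ≠ 0 := pow_ne_zero _ hw₀0
      have h4 : b ^ 2 ^ l ≠ 0 := pow_ne_zero _ hb
      rw [sub_zero, div_pow, div_eq_div_iff h3 hw₀0]
      refine mul_left_cancel₀ (mul_ne_zero h4 hb) ?_
      linear_combination b * W y * h1 - b * W x * h2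
    · push Not at h0
      have : R.image W ⊆ {0} := fun w hw => Finset.mem_singleton.mpr (h0 w hw)
      exact (Finset.card_le_card this).trans (Nat.one_le_pow _ _ (by norm_num))
  have hfib : ∀ w ∈ R.image W, (R.filter fun x => W x = w).card ≤ 2 ^ (2 * s).gcd (s + l) := by
    intro w hw
    obtain ⟨x₁, -, rfl⟩ := Finset.mem_image.mp hw
    rw [← Set.ncard_coe_finset]
    refine ncard_le_of_forall_div_fixed hF _ x₁ x₀ hx₀0 fun x hx => ?_
    -- `W` vanishes exactly where the quotient by `x₀` is fixed by `σ`.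
    have h1 : W (x - x₁) = 0 := by
      rw [hWadd, (Finset.mem_filter.mp (Finset.mem_coe.mp hx)).2, sub_self]
    rw [div_pow, div_eq_div_iff (pow_ne_zero _ hx₀0) hx₀0]
    simp only [hW] at h1
    linear_combination h1 - (x - x₁) * x₀ ^ 2 ^ (s + l) * CharTwo.two_eq_zero (R := F)
  rw [hcardR, sq]
  calc R.card ≤ 2 ^ (2 * s).gcd (s + l) * (R.image W).card :=
        Finset.card_le_mul_card_image _ _ hfib
    _ ≤ _ := Nat.mul_le_mul_left _ himage

/-- The polar form of the quadratic part of the words. -/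
noncomputable def polarForm (s l : ℕ) (a b : F) : LinearMap.BilinForm (ZMod 2) F :=
  AddMonoidHom.toZModLinearMap 2
    (AddMonoidHom.mk' (fun x => (Algebra.trace (ZMod 2) F).comp
      (LinearMap.mulLeft (ZMod 2) (polarMap s l a b x))) fun x y => by
        ext z
        simp only [LinearMap.comp_apply, LinearMap.mulLeft_apply, LinearMap.add_apply, ← map_add,
          polarMap, mul_add, add_pow_two_pow]
        congr 1
        ring)

theorem polarForm_apply {F : Type*} [Field F] [Algebra (ZMod 2) F] (s l : ℕ) (a b x y : F) :
    polarForm s l a b x y = Algebra.trace (ZMod 2) F (y * polarMap s l a b x) := by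
  rw [mul_comm]
  rfl

theorem polarForm_eq {s l : ℕ} (hF : Fintype.card F = 2 ^ (2 * s)) (hl : l ≤ 2 * s)
    (a : subfieldTwoPow F s) (b x y : F) :
    polarForm s l (a : F) b x y = kasamiWord s l hF a b 0 0 (x + y) +
      kasamiWord s l hF a b 0 0 x + kasamiWord s l hF a b 0 0 y := by
  have h2 : (2 : ZMod 2) = 0 := rfl
  rw [polarForm_apply, kasamiWord_add hF hl]
  linear_combination -(kasamiWord s l hF a b 0 0 x + kasamiWord s l hF a b 0 0 y) * h2

theorem polarForm_comm {s l : ℕ} (hF : Fintype.card F = 2 ^ (2 * s)) (hl : l ≤ 2 * s)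
    (a : subfieldTwoPow F s) (b x y : F) :
    polarForm s l (a : F) b x y = polarForm s l (a : F) b y x := by
  rw [polarForm_eq hF hl, polarForm_eq hF hl, add_comm x y]
  ring

theorem polarForm_self {s l : ℕ} (hF : Fintype.card F = 2 ^ (2 * s)) (hl : l ≤ 2 * s)
    (a : subfieldTwoPow F s) (b x : F) : polarForm s l (a : F) b x x = 0 := by
  have := charP_two_of_algebra F
  rw [polarForm_eq hF hl, CharTwo.add_self_eq_zero, kasamiWord_zero_right, zero_add,
    CharTwo.add_self_eq_zero]

theorem polarForm_mul_left {F : Type*} [Field F] [Algebra (ZMod 2) F] {s l d : ℕ} (hds : d ∣ s)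
    (hdl : d ∣ l) (a b : F)
    (c : subfieldTwoPow F d) (x y : F) :
    polarForm s l a b (c * x) y = polarForm s l a b x (c * y) := by
  have h1 : (c : F) ^ 2 ^ s = c := pow_two_pow_of_dvd c.2 hds
  have h2 : (c : F) ^ 2 ^ l = c := pow_two_pow_of_dvd c.2 hdl
  have h3 : (c : F) ^ 2 ^ (2 * s - l) = c :=
    pow_two_pow_of_dvd c.2 (Nat.dvd_sub (hds.mul_left 2) hdl)
  have h4 : polarMap s l a b (c * x) = c * polarMap s l a b x := by
    simp only [polarMap, mul_pow, h1, h2, h3]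
    ring
  rw [polarForm_apply, polarForm_apply, h4]
  congr 1
  ring

theorem polarForm_smul_smul {s l d : ℕ} (hF : Fintype.card F = 2 ^ (2 * s)) (hs : s ≠ 0)
    (hl : l ≤ 2 * s) (hds : d ∣ s) (hdl : d ∣ l) (a : subfieldTwoPow F s) (b : F)
    (c c' : subfieldTwoPow F d) (x : F) :
    polarForm s l (a : F) b (c * x) (c' * x) = 0 := by
  -- The square root of `c * c'`, by inverting the Frobenius. Moving scalars across the form reduces
  -- the claim to `polarForm_self` at `r * x`.
  set r : subfieldTwoPow F d := (c * c') ^ 2 ^ (2 * s - 1) with hr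
  have hr2 : (c * c' : F) = r * r := by
    rw [hr]
    push_cast
    rw [← sq, ← pow_mul, ← pow_succ, show 2 * s - 1 + 1 = 2 * s by omega, pow_two_pow_card hF]
  rw [polarForm_mul_left hds hdl, ← mul_assoc, hr2, mul_assoc, ← polarForm_mul_left hds hdl,
    polarForm_self hF hl]

/-- A maximal isotropic subspace over the field with `2 ^ d` elements works: a vector orthogonal to
it could be adjoined together with its whole line, because the line is isotropic by
`polarForm_smul_smul`. -/
theorem exists_self_orthogonal {s l d : ℕ} (hF : Fintype.card F = 2 ^ (2 * s)) (hs : s ≠ 0)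
    (hl : l ≤ 2 * s) (hds : d ∣ s) (hdl : d ∣ l) (a : subfieldTwoPow F s) (b : F) :
    ∃ U : Submodule (subfieldTwoPow F d) F, ∀ z, z ∈ U ↔ ∀ u ∈ U, polarForm s l (a : F) b u z = 0 := by
  set B := polarForm s l (a : F) b with hB
  obtain ⟨U, hU⟩ := (Set.toFinite {U : Submodule (subfieldTwoPow F d) F |
    ∀ u ∈ U, ∀ v ∈ U, B u v = 0}).exists_maximal ⟨⊥, by
      intro u hu v hv
      rw [(Submodule.mem_bot _).mp hu]
      simp⟩
  have hUiso : ∀ u ∈ U, ∀ v ∈ U, B u v = 0 := hU.prop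
  refine ⟨U, fun z => ⟨fun hz u hu => hUiso u hu z hz, fun hz => ?_⟩⟩
  have hle : U ⊔ Submodule.span _ {z} ≤ U := by
    refine hU.le_of_ge ?_ le_sup_left
    intro u hu v hv
    obtain ⟨u', hu', _, hp, rfl⟩ := Submodule.mem_sup.mp hu
    obtain ⟨v', hv', _, hq, rfl⟩ := Submodule.mem_sup.mp hv
    obtain ⟨p, rfl⟩ := Submodule.mem_span_singleton.mp hp
    obtain ⟨q, rfl⟩ := Submodule.mem_span_singleton.mp hq
    have e : ∀ c : subfieldTwoPow F d, c • z = (c : F) * z := fun _ => rfl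
    have h1 : B u' ((q : F) * z) = 0 := by
      rw [hB, ← polarForm_mul_left hds hdl]
      exact hz _ (U.smul_mem q hu')
    have h2 : B ((p : F) * z) v' = 0 := by
      rw [hB, polarForm_mul_left hds hdl, polarForm_comm hF hl]
      exact hz _ (U.smul_mem p hv')
    have h3 : B ((p : F) * z) ((q : F) * z) = 0 := polarForm_smul_smul hF hs hl hds hdl a b p q z
    rw [e, e, map_add, map_add, LinearMap.add_apply, LinearMap.add_apply, h1, h2, h3,
      hUiso u' hu' v' hv']
    simp
  exact hle (Submodule.mem_sup_right (Submodule.mem_span_singleton_self z))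

/-- If `U` equals its orthogonal, it contains the radical, and the dimension formula `dim U + dim
U^⊥ = dim F + dim (U ∩ R)` reads `|U| ^ 2 = q * |R|`. As a subspace, `U` has a power of `2 ^ d`
elements. -/
theorem exists_card_polarRadical_eq_sq {s l d : ℕ} (hF : Fintype.card F = 2 ^ (2 * s)) (hs : s ≠ 0)
    (hl : l ≤ 2 * s) (hds : d ∣ s) (hdl : d ∣ l) (a : subfieldTwoPow F s) (b : F) :
    ∃ u, 2 ^ (2 * s) * Nat.card (polarRadical s l (a : F) b) = ((2 ^ d) ^ u) ^ 2 := by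
  obtain ⟨U, hU⟩ := exists_self_orthogonal hF hs hl hds hdl a b
  set B := polarForm s l (a : F) b with hB
  have hrefl : B.IsRefl := fun x y h => by rw [hB, polarForm_comm hF hl, ← hB, h]
  set V := U.restrictScalars (ZMod 2) with hV
  have hVorth : B.orthogonal V = V := by
    ext z
    rw [LinearMap.BilinForm.mem_orthogonal_iff, hV, Submodule.restrictScalars_mem, hU]
    rfl
  have hinf : ∀ z, z ∈ V ⊓ B.orthogonal ⊤ ↔ z ∈ polarRadical s l (a : F) b := by
    intro z
    rw [Submodule.mem_inf, LinearMap.BilinForm.mem_orthogonal_iff, hV,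
      Submodule.restrictScalars_mem, mem_polarRadical]
    constructor
    · rintro ⟨-, h⟩
      refine trace_eq_zero_of_forall fun y => ?_
      rw [← polarForm_apply, polarForm_comm hF hl]
      exact h y Submodule.mem_top
    · intro h
      have : ∀ u, B u z = 0 := fun u => by
        rw [hB, polarForm_comm hF hl, polarForm_apply, h, mul_zero, map_zero]
      exact ⟨(hU z).mpr fun u _ => this u, fun u _ => this u⟩
  have hfin := LinearMap.BilinForm.finrank_add_finrank_orthogonal hrefl V
  rw [hVorth] at hfin
  have h1 := Module.natCard_eq_pow_finrank (K := ZMod 2) (V := (V ⊓ B.orthogonal ⊤ : Submodule _ _))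
  have h2 : Nat.card (V ⊓ B.orthogonal ⊤ : Submodule _ _) =
      Nat.card (polarRadical s l (a : F) b) := Nat.card_congr (Equiv.subtypeEquivRight hinf)
  have h3 := Module.natCard_eq_pow_finrank (K := ZMod 2) (V := V)
  have h4 := Module.natCard_eq_pow_finrank (K := ZMod 2) (V := F)
  have h5 := Module.natCard_eq_pow_finrank (K := subfieldTwoPow F d) (V := U)
  have h6 : Nat.card V = Nat.card U := rfl
  rw [natCard_subfieldTwoPow hF, Nat.gcd_eq_right (hds.mul_left 2), ← h6] at h5
  rw [Nat.card_zmod] at h1 h3 h4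
  rw [Nat.card_eq_fintype_card, hF] at h4
  refine ⟨Module.finrank (subfieldTwoPow F d) U, ?_⟩
  rw [← h5, ← h2, h1, h3, h4, ← pow_add, ← hfin, sq, pow_add]

/-- The common fixed field of the Frobenius powers involved in the radical. -/
theorem gcd_two_mul_add (s l : ℕ) : (2 * s).gcd (s + l) = (s + l).gcd (2 * l) := by
  rw [Nat.gcd_comm]
  apply Nat.dvd_antisymm
  · refine Nat.dvd_gcd (Nat.gcd_dvd_left _ _) ?_
    have := Nat.dvd_sub ((Nat.gcd_dvd_left (s + l) (2 * s)).mul_left 2)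
      (Nat.gcd_dvd_right (s + l) (2 * s))
    rwa [show 2 * (s + l) - 2 * s = 2 * l by omega] at this
  · refine Nat.dvd_gcd (Nat.gcd_dvd_left _ _) ?_
    have := Nat.dvd_sub ((Nat.gcd_dvd_left (s + l) (2 * l)).mul_left 2)
      (Nat.gcd_dvd_right (s + l) (2 * l))
    rwa [show 2 * (s + l) - 2 * l = 2 * s by omega] at this

theorem exists_card_polarRadical {s l d' : ℕ} (hF : Fintype.card F = 2 ^ (2 * s))
    (hl : l ≤ 2 * s) (hd' : d' = (s + l).gcd (2 * l)) (hd'0 : d' ≠ 0)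
    {a b : F} (hab : ¬ (a = 0 ∧ b = 0)) :
    ∃ j ≤ 2, Nat.card (polarRadical s l a b) = (2 ^ d') ^ j := by
  have hd2 : d' = (2 * s).gcd (s + l) := by rw [gcd_two_mul_add, hd']
  obtain ⟨j, hj⟩ := exists_card_polarRadical_eq_pow hF hl
    (hd'.symm ▸ Nat.gcd_dvd_left _ _ : d' ∣ s + l) (hd2.symm ▸ Nat.gcd_dvd_left _ _) a b
  refine ⟨j, ?_, hj⟩
  have := card_polarRadical_le hF hl hab
  rw [hj, ← hd2] at this
  exact (Nat.pow_le_pow_iff_right (Nat.one_lt_two_pow hd'0)).mp this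

theorem card_polarRadical_of_eq {s l d : ℕ} (hF : Fintype.card F = 2 ^ (2 * s)) (hs : s ≠ 0)
    (hl : l ≤ 2 * s) (hd : d = s.gcd l) (hd' : d = (s + l).gcd (2 * l))
    {a : subfieldTwoPow F s} {b : F} (hab : ¬ (a = 0 ∧ b = 0)) :
    Nat.card (polarRadical s l (a : F) b) = 1 ∨
      Nat.card (polarRadical s l (a : F) b) = 2 ^ (2 * d) := by
  have hd0 : d ≠ 0 := by
    rw [hd]
    exact (Nat.gcd_pos_of_pos_left _ (Nat.pos_of_ne_zero hs)).ne'
  have hds : d ∣ s := hd ▸ Nat.gcd_dvd_left _ _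
  obtain ⟨j, hj2, hj⟩ := exists_card_polarRadical (a := (a : F)) (b := b) hF hl hd' hd0
    (by simpa using hab)
  obtain ⟨u, hu⟩ := exists_card_polarRadical_eq_sq hF hs hl hds
    (hd ▸ Nat.gcd_dvd_right _ _) a b
  interval_cases j
  · left
    simpa using hj
  · exfalso
    -- Parity: with `s = d * n`, a radical of size `2 ^ d` would give `2 * n + 1 = 2 * u`.
    rw [hj, ← pow_mul, ← pow_mul, ← pow_mul, ← pow_add] at hu
    have h1 := Nat.pow_right_injective le_rfl hu
    obtain ⟨n, rfl⟩ := hds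
    have h2 : d * (2 * n + 1) = d * (2 * u) := by linarith
    have := Nat.eq_of_mul_eq_mul_left (Nat.pos_of_ne_zero hd0) h2
    omega
  · right
    rw [hj, ← pow_mul, mul_comm]

end Radical

/-! ### Moment identities over all pairs `(a, b)`. -/

section Moments

variable {F : Type*} [Field F] [Fintype F] [Algebra (ZMod 2) F]

theorem pow_two_pow_gcd {M : Type*} [Monoid M] {x : M} {i j : ℕ} (hi : x ^ 2 ^ i = x)
    (hj : x ^ 2 ^ j = x) : x ^ 2 ^ i.gcd j = x := by
  have key : ∀ n, Function.IsPeriodicPt (fun y : M => y ^ 2) n x ↔ x ^ 2 ^ n = x := by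
    intro n
    rw [Function.IsPeriodicPt, pow_iterate, Function.IsFixedPt]
  rw [← key] at *
  exact hi.gcd hj

/-- The condition says that the relative trace lies in the intersection of two fixed fields, which
has `2 ^ gcd s l` elements; each fibre of the relative trace has `2 ^ s`. -/
theorem ncard_relTrace_fixed {s l : ℕ} (hF : Fintype.card F = 2 ^ (2 * s)) (hl : l ≤ 2 * s) :
    {z : F | (relTrace s hF z : F) ^ 2 ^ (2 * s - l) = relTrace s hF z}.ncard =
      2 ^ s * 2 ^ s.gcd l := by
  have hg : s.gcd (2 * s - l) = s.gcd l := by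
    apply Nat.dvd_antisymm
    · refine Nat.dvd_gcd (Nat.gcd_dvd_left _ _) ?_
      have := Nat.dvd_sub ((Nat.gcd_dvd_left s (2 * s - l)).mul_left 2)
        (Nat.gcd_dvd_right s (2 * s - l))
      rwa [show 2 * s - (2 * s - l) = l by omega] at this
    · exact Nat.dvd_gcd (Nat.gcd_dvd_left _ _)
        (Nat.dvd_sub ((Nat.gcd_dvd_left s l).mul_left 2) (Nat.gcd_dvd_right s l))
  let Y : AddSubgroup (subfieldTwoPow F s) :=
    { carrier := {y | (y : F) ^ 2 ^ (s.gcd l) = y}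
      zero_mem' := by simp
      add_mem' := fun {x y} hx hy => by
        simp only [Set.mem_ofPred_eq, AddMemClass.coe_add, add_pow_two_pow] at *
        rw [hx, hy]
      neg_mem' := fun {x} hx => by
        have := charP_two_of_algebra F
        simpa [CharTwo.neg_eq] using hx }
  have hY : Nat.card Y = 2 ^ s.gcd l := by
    have h1 := natCard_subfieldTwoPow hF (s.gcd l)
    rw [Nat.gcd_eq_right ((Nat.gcd_dvd_left s l).mul_left 2)] at h1
    rw [← h1]
    exact Nat.card_congr
      { toFun := fun y => ⟨y.1, y.2⟩
        invFun := fun y => ⟨⟨y.1, pow_two_pow_of_dvd y.2 (Nat.gcd_dvd_left _ _)⟩, y.2⟩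
        left_inv := fun _ => rfl
        right_inv := fun _ => rfl }
  have hset : {z : F | (relTrace s hF z : F) ^ 2 ^ (2 * s - l) = relTrace s hF z} =
      (Y.comap (relTrace s hF) : Set F) := by
    ext z
    change (relTrace s hF z : F) ^ 2 ^ (2 * s - l) = relTrace s hF z ↔
      (relTrace s hF z : F) ^ 2 ^ (s.gcd l) = relTrace s hF z
    constructor
    · intro h
      rw [← hg]
      exact pow_two_pow_gcd (relTrace s hF z).2 h
    · intro h
      exact pow_two_pow_of_dvd h (hg ▸ Nat.gcd_dvd_right _ _)
  rw [hset, ← hY]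
  change Nat.card (Y.comap (relTrace s hF)) = _
  have h1 := (Y.comap (relTrace s hF)).card_mul_index
  have h2 := Y.card_mul_index
  rw [AddSubgroup.index_comap_of_surjective _ (relTrace_surjective s hF),
    Nat.card_eq_fintype_card (α := F), hF, two_mul, pow_add] at h1
  rw [natCard_subfieldTwoPow_half s hF] at h2
  have h3 : 0 < Y.index := Nat.pos_of_ne_zero AddSubgroup.index_ne_zero_of_finite
  refine Nat.eq_of_mul_eq_mul_right h3 ?_
  rw [h1, mul_assoc, h2]

theorem mul_polarMap {F : Type*} [Field F] [Fintype F] {s l : ℕ}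
    (hF : Fintype.card F = 2 ^ (2 * s)) (hl : l ≤ 2 * s) (a b x : F) :
    x * polarMap s l a b x = a * x ^ (2 ^ s + 1) +
      (b * x ^ (2 ^ l + 1) + (b * x ^ (2 ^ l + 1)) ^ 2 ^ (2 * s - l)) := by
  have h1 : (b * x ^ (2 ^ l + 1)) ^ 2 ^ (2 * s - l) = (b * x) ^ 2 ^ (2 * s - l) * x := by
    rw [pow_succ', ← mul_assoc, mul_pow _ (x ^ 2 ^ l), pow_two_pow_pow, Nat.add_sub_cancel' hl,
      pow_two_pow_card hF]
  rw [h1, polarMap]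
  ring

/-- With `z = b * x ^ (2 ^ l + 1)` the equation determines `a` from `z`. The only constraint is that
this `a` lie in the subfield, which is the condition on `z` counted in `ncard_relTrace_fixed`. -/
theorem ncard_polarMap_eq_zero {s l : ℕ} (hF : Fintype.card F = 2 ^ (2 * s)) (hl : l ≤ 2 * s)
    {x : F} (hx : x ≠ 0) :
    {p : subfieldTwoPow F s × F | polarMap s l (p.1 : F) p.2 x = 0}.ncard =
      2 ^ s * 2 ^ s.gcd l := by
  have := charP_two_of_algebra F
  have hN : (x ^ (2 ^ s + 1)) ^ 2 ^ s = x ^ (2 ^ s + 1) := (powToSubfield s hF x).2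
  have hxs : x ^ (2 ^ s + 1) ≠ 0 := pow_ne_zero _ hx
  have hxl : x ^ (2 ^ l + 1) ≠ 0 := pow_ne_zero _ hx
  have hiff : ∀ (a b : F), polarMap s l a b x = 0 ↔ a * x ^ (2 ^ s + 1) =
      b * x ^ (2 ^ l + 1) + (b * x ^ (2 ^ l + 1)) ^ 2 ^ (2 * s - l) := by
    intro a b
    rw [← mul_right_inj' hx, mul_zero, mul_polarMap hF hl, CharTwo.add_eq_zero]
  have hmem : ∀ z : F, (relTrace s hF z : F) ^ 2 ^ (2 * s - l) = relTrace s hF z ↔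
      (z + z ^ 2 ^ (2 * s - l)) ^ 2 ^ s = z + z ^ 2 ^ (2 * s - l) := by
    intro z
    rw [coe_relTrace, add_pow_two_pow, add_pow_two_pow, pow_two_pow_comm z _ s,
      ← CharTwo.add_eq_zero, ← CharTwo.add_eq_zero (a := z ^ 2 ^ s + _)]
    constructor <;> intro h <;> linear_combination h
  rw [← ncard_relTrace_fixed hF hl]
  refine Set.ncard_congr (fun p _ => p.2 * x ^ (2 ^ l + 1)) ?_ ?_ ?_
  · rintro ⟨a, b⟩ h
    simp only [Set.mem_ofPred_eq] at h ⊢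
    rw [hmem, ← (hiff a b).mp h, mul_pow, hN, pow_coe_subfieldTwoPow]
  · rintro ⟨a, b⟩ ⟨a', b'⟩ h h' heq
    simp only [Set.mem_ofPred_eq] at h h' heq
    rw [hiff] at h h'
    have hb : b = b' := mul_right_cancel₀ hxl heq
    subst hb
    rw [← h'] at h
    exact Prod.ext (Subtype.ext (mul_right_cancel₀ hxs h)) rfl
  · intro z hz
    rw [Set.mem_ofPred_eq, hmem] at hz
    refine ⟨(⟨(z + z ^ 2 ^ (2 * s - l)) / x ^ (2 ^ s + 1), ?_⟩, z / x ^ (2 ^ l + 1)), ?_, ?_⟩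
    · change ((z + z ^ 2 ^ (2 * s - l)) / x ^ (2 ^ s + 1)) ^ 2 ^ s = _
      rw [div_pow, hz, hN]
    · simp only [Set.mem_ofPred_eq]
      rw [hiff, div_mul_cancel₀ _ hxs, div_mul_cancel₀ _ hxl]
    · exact div_mul_cancel₀ _ hxl

theorem card_parameters {s : ℕ} (hF : Fintype.card F = 2 ^ (2 * s)) :
    Fintype.card (subfieldTwoPow F s × F) = 2 ^ (3 * s) := by
  rw [Fintype.card_prod, hF, ← Nat.card_eq_fintype_card, natCard_subfieldTwoPow_half s hF, ← pow_add]
  congr 1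
  ring

/-- Double counting of the incidences between pairs `(a, b)` and elements `x` of their radicals; `x
= 0` belongs to all of them. -/
theorem sum_card_polarRadical {s l : ℕ} (hF : Fintype.card F = 2 ^ (2 * s)) (hl : l ≤ 2 * s) :
    ∑ p : subfieldTwoPow F s × F, Nat.card (polarRadical s l (p.1 : F) p.2) =
      2 ^ (3 * s) + (2 ^ (2 * s) - 1) * (2 ^ s * 2 ^ s.gcd l) := by
  classical
  have h := Finset.sum_card_bipartiteAbove_eq_sum_card_bipartiteBelow
    (s := (Finset.univ : Finset (subfieldTwoPow F s × F))) (t := (Finset.univ : Finset F))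
    (fun p x => polarMap s l (p.1 : F) p.2 x = 0)
  have h1 : ∀ p : subfieldTwoPow F s × F, Nat.card (polarRadical s l (p.1 : F) p.2) =
      (Finset.bipartiteAbove (fun (p : subfieldTwoPow F s × F) x => polarMap s l (p.1 : F) p.2 x = 0)
        Finset.univ p).card := by
    intro p
    rw [Nat.card_eq_fintype_card, Fintype.card_subtype]
    rfl
  have h2 : ∀ x : F, (Finset.bipartiteBelow
      (fun (p : subfieldTwoPow F s × F) x => polarMap s l (p.1 : F) p.2 x = 0)
        Finset.univ x).card = if x = 0 then 2 ^ (3 * s) else 2 ^ s * 2 ^ s.gcd l := by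
    intro x
    split_ifs with hx
    · rw [← card_parameters hF, ← Finset.card_univ, Finset.bipartiteBelow, hx]
      simp [polarMap]
    · rw [← ncard_polarMap_eq_zero hF hl hx, ← Set.ncard_coe_finset]
      simp [Finset.bipartiteBelow]
  simp_rw [h1]
  rw [h, Finset.sum_congr rfl fun x _ => h2 x, ← Finset.add_sum_erase _ _ (Finset.mem_univ (0 : F)),
    if_pos rfl, Finset.sum_congr rfl fun x hx => if_neg (Finset.ne_of_mem_erase hx),
    Finset.sum_const, Finset.card_erase_of_mem (Finset.mem_univ _), Finset.card_univ, hF,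
    smul_eq_mul]

/-- After exchanging sums, summation over `b` kills every `x ≠ 0` by orthogonality. -/
theorem sum_walshSum_quadratic {s l : ℕ} (hF : Fintype.card F = 2 ^ (2 * s)) :
    ∑ p : subfieldTwoPow F s × F, walshSum (kasamiWord s l hF p.1 p.2 0 0) = 2 ^ (3 * s) := by
  classical
  simp only [walshSum]
  rw [Finset.sum_comm]
  have h1 : ∀ x : F, ∑ p : subfieldTwoPow F s × F, binarySign (kasamiWord s l hF p.1 p.2 0 0 x) =
      if x = 0 then 2 ^ (3 * s) else 0 := by
    intro x
    split_ifs with hx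
    · simp only [hx, kasamiWord_zero_right, binarySign_zero, Finset.sum_const, Finset.card_univ,
        card_parameters hF, nsmul_eq_mul, mul_one, Nat.cast_pow, Nat.cast_ofNat]
    · rw [Fintype.sum_prod_type]
      refine Finset.sum_eq_zero fun a _ => ?_
      have h2 : ∀ b : F, binarySign (kasamiWord s l hF a b 0 0 x) =
          binarySign (kasamiWord s l hF a 0 0 0 x) *
            binarySign (Algebra.trace (ZMod 2) F (b * x ^ (2 ^ l + 1))) := by
        intro b
        rw [← binarySign_add]
        simp [kasamiWord]
      rw [Finset.sum_congr rfl fun b _ => h2 b, ← Finset.mul_sum, sum_binarySign_trace_mul,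
        if_neg (pow_ne_zero _ hx), Nat.cast_zero, mul_zero]
  simp_rw [h1]
  simp

/-- The character sum of a function invariant under a group of roots of unity. -/
theorem dvd_walshSum_sub_one {F : Type*} [Field F] [Fintype F] {n : ℕ}
    (hn : n ∣ Fintype.card F - 1) (f : F → ZMod 2) (h0 : f 0 = 0)
    (hf : ∀ u x, u ^ n = 1 → f (u * x) = f x) : (n : ℤ) ∣ walshSum f - 1 := by
  classical
  set H := (powMonoidHom n : Fˣ →* Fˣ).ker with hH
  have hcard : Nat.card H = n := by
    rw [hH, IsCyclic.card_powMonoidHom_ker, Nat.card_units, Nat.card_eq_fintype_card,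
      Nat.gcd_eq_right hn]
  have h1 : walshSum f - 1 = ∑ x : Fˣ, binarySign (f x) := by
    rw [walshSum, ← Finset.add_sum_erase _ _ (Finset.mem_univ (0 : F)), h0, binarySign_zero,
      add_sub_cancel_left]
    symm
    refine Finset.sum_bij (fun x _ => (x : F)) ?_ ?_ ?_ ?_
    · intro x _
      simp
    · intro x _ y _ h
      exact Units.ext h
    · intro x hx
      exact ⟨Units.mk0 x (Finset.ne_of_mem_erase hx), Finset.mem_univ _, rfl⟩
    · intro x _
      rfl
  -- The nonempty fibres of the `n`-th power map are cosets of the `n`-th roots of unity: each has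
  -- `n` elements, and `f` is constant on it.
  rw [h1, ← Finset.sum_fiberwise (Finset.univ : Finset Fˣ) (powMonoidHom n)]
  refine Finset.dvd_sum fun y _ => ?_
  by_cases hy : ∃ x₁, powMonoidHom n x₁ = y
  · obtain ⟨x₁, rfl⟩ := hy
    have h2 : ∀ x ∈ Finset.univ.filter fun x => powMonoidHom n x = powMonoidHom n x₁,
        binarySign (f (x : F)) = binarySign (f (x₁ : F)) := by
      intro x hx
      have h3 : x ^ n = x₁ ^ n := (Finset.mem_filter.mp hx).2
      rw [← hf ((x / x₁ : Fˣ) : F) x₁ (by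
        rw [← Units.val_pow_eq_pow_val, div_pow, h3, div_self', Units.val_one])]
      simp
    rw [Finset.sum_congr rfl h2, Finset.sum_const, nsmul_eq_mul,
      MonoidHom.card_fiber_eq_of_mem_range (powMonoidHom n) ⟨x₁, rfl⟩ ⟨1, map_one _⟩]
    have h4 : (Finset.univ.filter fun x : Fˣ => powMonoidHom n x = 1).card = n := by
      rw [← Fintype.card_subtype, ← Nat.card_eq_fintype_card]
      exact hcard
    rw [h4]
    exact dvd_mul_right _ _
  · push Not at hy
    rw [Finset.filter_false_of_mem fun x _ => hy x]
    simp

end Moments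

/-! ### From class sizes to the weight distribution. -/

section Distribution

variable {F : Type*} [Field F] [Fintype F] [Algebra (ZMod 2) F]

/-- One vector `N` of class sizes serves for all summands `g` that depend only on the class away
from `p₀`, so the moments and the weight counts involve the same unknowns. It is rational because
the linear system is solved over `ℚ`. -/
theorem exists_class_counts {ι : Type*} [Fintype ι] (p₀ : ι) (k : ℕ) (c : ι → ℕ)
    (hc : ∀ p ≠ p₀, c p < k) :
    ∃ N : ℕ → ℚ, ∀ (g : ι → ℚ) (v : ℕ → ℚ), (∀ p ≠ p₀, g p = v (c p)) →
      ∑ p, g p = g p₀ + ∑ j ∈ Finset.range k, N j * v j := by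
  classical
  refine ⟨fun j => (((Finset.univ.erase p₀).filter fun p => c p = j).card : ℚ), fun g v hg => ?_⟩
  rw [← Finset.add_sum_erase _ _ (Finset.mem_univ p₀),
    ← Finset.sum_fiberwise_of_maps_to (t := Finset.range k) (g := c)
      fun p hp => Finset.mem_range.mpr (hc p (Finset.ne_of_mem_erase hp))]
  congr 1
  refine Finset.sum_congr rfl fun j _ => ?_
  rw [← nsmul_eq_mul, ← Finset.sum_const]
  refine Finset.sum_congr rfl fun p hp => ?_
  rw [Finset.mem_filter, Finset.mem_erase] at hp
  rw [hg p hp.1.1, hp.2]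

theorem card_polarRadical_zero {s l : ℕ} (hF : Fintype.card F = 2 ^ (2 * s)) :
    Nat.card (polarRadical s l ((0 : subfieldTwoPow F s) : F) (0 : F)) = 2 ^ (2 * s) := by
  have : polarRadical s l ((0 : subfieldTwoPow F s) : F) (0 : F) = ⊤ := by
    rw [AddSubgroup.eq_top_iff']
    intro x
    simp [mem_polarRadical, polarMap]
  rw [this, AddSubgroup.card_top, Nat.card_eq_fintype_card, hF]

/-- The weight distribution in terms of the numbers `N j` of quadratic parts whose radical has
`2 ^ (2 * d * j)` elements. -/
theorem exists_weight_distribution {s l d k : ℕ} (hF : Fintype.card F = 2 ^ (2 * s))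
    (hl : l ≤ 2 * s) (hd0 : d ≠ 0) (hk : ∀ j < k, d * j < s)
    (hcard : ∀ (a : subfieldTwoPow F s) (b : F), ¬ (a = 0 ∧ b = 0) →
      ∃ j < k, Nat.card (polarRadical s l (a : F) b) = 2 ^ (2 * (d * j))) :
    ∃ N : ℕ → ℚ,
      1 + ∑ j ∈ Finset.range k, N j = 2 ^ (3 * s) ∧
      2 ^ (2 * s) + ∑ j ∈ Finset.range k, N j * 2 ^ (2 * (d * j)) =
        2 ^ (3 * s) + (2 ^ (2 * s) - 1) * (2 ^ s * 2 ^ s.gcd l) ∧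
      (∀ v : ℕ → ℤ, (∀ (a : subfieldTwoPow F s) (b : F), ¬ (a = 0 ∧ b = 0) →
        ∀ j, Nat.card (polarRadical s l (a : F) b) = 2 ^ (2 * (d * j)) →
          walshSum (kasamiWord s l hF a b 0 0) = v j) →
        2 ^ (2 * s) + ∑ j ∈ Finset.range k, N j * v j = 2 ^ (3 * s)) ∧
      (∀ j < k, ∀ i : ℕ, (2 ^ (2 * s) - 2 * i : ℤ) ^ 2 = (2 ^ (s + d * j)) ^ 2 →
        ({w | w ∈ kasamiCode F s l hF ∧ hammingNorm w = i}.ncard : ℚ) * 2 ^ (2 * (d * j)) =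
          N j * 2 ^ (2 * s)) ∧
      (∀ i : ℕ, (2 ^ (2 * s) - 2 * i : ℤ) = 0 →
        ({w | w ∈ kasamiCode F s l hF ∧ hammingNorm w = i}.ncard : ℚ) =
          2 * (2 ^ (2 * s) - 1) +
            ∑ j ∈ Finset.range k, N j * (2 * (2 ^ (2 * s) - 2 ^ (2 * s) / 2 ^ (2 * (d * j))))) := by
  classical
  have hex : ∀ p : subfieldTwoPow F s × F, ∃ j, p ≠ 0 → j < k ∧
      Nat.card (polarRadical s l (p.1 : F) p.2) = 2 ^ (2 * (d * j)) := by
    intro p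
    by_cases hp : p = 0
    · exact ⟨0, fun h => absurd hp h⟩
    · obtain ⟨j, hj⟩ := hcard p.1 p.2 fun h => hp (Prod.ext h.1 h.2)
      exact ⟨j, fun _ => hj⟩
  choose c hc using hex
  obtain ⟨N, hN⟩ := exists_class_counts (0 : subfieldTwoPow F s × F) k c fun p hp => (hc p hp).1
  -- By `hk` the radical of a nonzero pair has fewer than `2 ^ (2 * s)` elements, so it is not all
  -- of `F`.
  have hrad : ∀ (a : subfieldTwoPow F s) (b : F), (∀ x, polarMap s l (a : F) b x = 0) →
      a = 0 ∧ b = 0 := by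
    intro a b h
    by_contra hab
    obtain ⟨j, hj, hR⟩ := hcard a b hab
    have htop : polarRadical s l (a : F) b = ⊤ := (AddSubgroup.eq_top_iff' _).mpr h
    rw [htop, AddSubgroup.card_top, Nat.card_eq_fintype_card, hF] at hR
    have := Nat.pow_right_injective le_rfl hR
    have := hk j hj
    omega
  have hinj : ∀ i j, (2 : ℤ) ^ (2 * (d * i)) = 2 ^ (2 * (d * j)) → i = j := by
    intro i j h
    have h1 : 2 * (d * i) = 2 * (d * j) :=
      Nat.pow_right_injective le_rfl (by exact_mod_cast h : (2 : ℕ) ^ _ = 2 ^ _)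
    exact Nat.eq_of_mul_eq_mul_left (Nat.pos_of_ne_zero hd0) (by omega)
  refine ⟨N, ?_, ?_, ?_, ?_, ?_⟩
  · have := hN (fun _ => 1) (fun _ => 1) (fun _ _ => rfl)
    simp only [Finset.sum_const, Finset.card_univ, card_parameters hF, nsmul_eq_mul, mul_one] at this
    rw [← this]
    push_cast
    rfl
  · have := hN (fun p => (Nat.card (polarRadical s l (p.1 : F) p.2) : ℚ))
      (fun j => 2 ^ (2 * (d * j))) (fun p hp => by rw [(hc p hp).2]; push_cast; rfl)
    have h1 : ((0 : subfieldTwoPow F s × F).1 : F) = ((0 : subfieldTwoPow F s) : F) := rfl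
    have h2 : (0 : subfieldTwoPow F s × F).2 = 0 := rfl
    rw [← Nat.cast_sum, sum_card_polarRadical hF hl, h1, h2, card_polarRadical_zero hF] at this
    push_cast [Nat.one_le_two_pow] at this
    exact this.symm
  · intro v hv
    have := hN (fun p => (walshSum (kasamiWord s l hF p.1 p.2 0 0) : ℚ)) (fun j => v j)
      (fun p hp => by rw [hv p.1 p.2 (fun h => hp (Prod.ext h.1 h.2)) _ (hc p hp).2])
    rw [← Int.cast_sum, sum_walshSum_quadratic hF] at this
    have h0 : walshSum (kasamiWord s l hF (0 : subfieldTwoPow F s × F).1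
        (0 : subfieldTwoPow F s × F).2 0 0) = 2 ^ (2 * s) := by
      have : ∀ x, kasamiWord s l hF (0 : subfieldTwoPow F s × F).1
        (0 : subfieldTwoPow F s × F).2 0 0 x = 0 := fun x => by simp [kasamiWord]
      simp only [walshSum, this, binarySign_zero, Finset.sum_const, Finset.card_univ, hF,
        nsmul_eq_mul, mul_one, Nat.cast_pow, Nat.cast_ofNat]
    rw [h0] at this
    push_cast at this
    exact this.symm
  · intro j hj i hi
    rw [ncard_hammingNorm_kasamiCode hF hl hrad, hF]
    push_cast
    set T : ℤ := 2 ^ (2 * s) - 2 * i with hT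
    have hT0 : T ≠ 0 := by
      intro h
      rw [h] at hi
      have : (0 : ℤ) < (2 ^ (s + d * j)) ^ 2 := by positivity
      rw [← hi] at this
      norm_num at this
    have hT2 : T ^ 2 = 2 ^ (2 * s) * 2 ^ (2 * (d * j)) := by
      rw [hi, ← pow_mul, ← pow_add]
      congr 1
      ring
    have := hN (fun p => (walshCount s l hF p.1 p.2 T : ℚ))
      (fun i => if i = j then 2 ^ (2 * s) / 2 ^ (2 * (d * j)) else 0) (fun p hp => by
        split_ifs with h
        · have h1 := walshCount_mul_card_radical hF hl p.1 p.2 hT0 (by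
            rw [hT2, hF, (hc p hp).2, h]
            push_cast
            rfl)
          rw [(hc p hp).2, h, hF] at h1
          rw [eq_div_iff (by positivity)]
          exact_mod_cast h1
        · rw [walshCount_eq_zero hF hl p.1 p.2 hT0, Nat.cast_zero]
          rw [hT2, hF, (hc p hp).2]
          push_cast
          intro h1
          exact h (hinj _ _ (mul_left_cancel₀ (by positivity) h1)).symm)
    -- Only class `j` contributes. The zero pair does not, since its radical is `F` and `d * j < s`.
    rw [this, walshCount_eq_zero hF hl _ _ hT0, Finset.sum_eq_single_of_mem j (Finset.mem_range.mpr hj)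
      (fun i _ h => by rw [if_neg h, mul_zero]), if_pos rfl, Nat.cast_zero, zero_add]
    · field_simp
    · have h1 : ((0 : subfieldTwoPow F s × F).1 : F) = ((0 : subfieldTwoPow F s) : F) := rfl
      have h2 : (0 : subfieldTwoPow F s × F).2 = 0 := rfl
      rw [hT2, h1, h2, card_polarRadical_zero hF, hF]
      push_cast
      intro h3
      have h4 : (2 : ℤ) ^ (2 * (d * j)) = 2 ^ (2 * s) := mul_left_cancel₀ (by positivity) h3
      have h5 : 2 * (d * j) = 2 * s :=
        Nat.pow_right_injective le_rfl (by exact_mod_cast h4 : (2 : ℕ) ^ _ = 2 ^ _)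
      have := hk j hj
      omega
  · intro i hi
    rw [ncard_hammingNorm_kasamiCode hF hl hrad, hF]
    push_cast
    rw [hi]
    have key : ∀ p : subfieldTwoPow F s × F, ∀ r : ℕ,
        Nat.card (polarRadical s l (p.1 : F) p.2) = 2 ^ r →
        (walshCount s l hF p.1 p.2 0 : ℚ) = 2 * (2 ^ (2 * s) - 2 ^ (2 * s) / 2 ^ r) := by
      intro p r hr
      have h1 := walshCount_zero hF hl p.1 p.2
      rw [hr, hF] at h1
      have h2 : (walshCount s l hF p.1 p.2 0 : ℚ) * 2 ^ r + 2 * 2 ^ (2 * s) =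
        2 * 2 ^ (2 * s) * 2 ^ r := by exact_mod_cast h1
      field_simp
      linear_combination h2
    -- The zero pair accounts for the affine words, of which `2 * (q - 1)` are balanced.
    rw [hN (fun p => (walshCount s l hF p.1 p.2 0 : ℚ))
      (fun j => 2 * (2 ^ (2 * s) - 2 ^ (2 * s) / 2 ^ (2 * (d * j)))) fun p hp => key p _ (hc p hp).2,
      key 0 (2 * s) (card_polarRadical_zero hF), div_self (by positivity)]

end Distribution

/-! ### Arithmetic of `s`, `l` and `d`. -/

section Divisibility

/-- If `d` were `s`, then `l` would be a positive multiple of `s` below `2 * s`, that is, `s`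
itself. So `d` is a proper divisor of `s`. -/
theorem two_mul_le_of_gcd {s l d : ℕ} (hl : 1 ≤ l) (hlm : l ≤ 2 * s - 1)
    (hls : l ≠ s) (hd : d = s.gcd l) : 1 ≤ d ∧ 2 * d ≤ s := by
  have hd0 : 0 < d := hd ▸ Nat.gcd_pos_of_pos_right _ hl
  refine ⟨hd0, ?_⟩
  obtain ⟨n, hn⟩ : d ∣ s := hd ▸ Nat.gcd_dvd_left _ _
  obtain ⟨k, hk⟩ : d ∣ l := hd ▸ Nat.gcd_dvd_right _ _
  have hn0 : n ≠ 0 := by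
    rintro rfl
    omega
  have hn1 : n ≠ 1 := by
    rintro rfl
    have hk2 : k < 2 := by
      by_contra h
      have : d * 2 ≤ d * k := Nat.mul_le_mul_left _ (by omega)
      omega
    interval_cases k <;> omega
  have : d * 2 ≤ d * n := Nat.mul_le_mul_left _ (by omega)
  omega

/-- As `2 * d` divides `s + l`, the coprime quotients `s / d` and `l / d` have an even sum, so both
are odd. -/
theorem odd_quotients_of_gcd {s l d : ℕ} (hd0 : d ≠ 0) (hd : d = s.gcd l)
    (hd' : 2 * d = (s + l).gcd (2 * l)) : ∃ n k, s = d * n ∧ l = d * k ∧ Odd n ∧ Odd k := by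
  have hpos : 0 < s.gcd l := by omega
  obtain ⟨n, k, hcop, hn, hk⟩ := Nat.exists_coprime s l
  rw [← hd] at hn hk
  have hsum : n.gcd k = 1 := hcop
  have h1 : d * 2 ∣ d * (n + k) := by
    have := Nat.gcd_dvd_left (s + l) (2 * l)
    rw [← hd', hn, hk] at this
    rwa [← add_mul, mul_comm 2 d, mul_comm _ d] at this
  have h2 : 2 ∣ n + k := Nat.dvd_of_mul_dvd_mul_left (Nat.pos_of_ne_zero hd0) h1
  have h3 : Odd n ∧ Odd k := by
    rcases Nat.even_or_odd n with he | ho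
    · have hke : Even k := by
        rw [← even_iff_two_dvd, Nat.even_add] at h2
        exact h2.mp he
      have := Nat.dvd_gcd he.two_dvd hke.two_dvd
      rw [hsum] at this
      norm_num at this
    · refine ⟨ho, ?_⟩
      rw [← even_iff_two_dvd, Nat.even_add] at h2
      by_contra hk
      exact (Nat.not_even_iff_odd.mpr ho) (h2.mpr (Nat.not_odd_iff_even.mp hk))
  exact ⟨n, k, by rw [hn, mul_comm], by rw [hk, mul_comm], h3⟩

theorem two_pow_add_one_dvd_of_odd (d : ℕ) {n : ℕ} (hn : Odd n) :
    2 ^ d + 1 ∣ 2 ^ (d * n) + 1 := by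
  have := hn.nat_add_dvd_pow_add_pow (2 ^ d) 1
  rwa [one_pow, ← pow_mul] at this

end Divisibility

/-! ### The sign of the character sums when `s / d` and `l / d` are odd. -/

section Sign

variable {F : Type*} [Field F] [Fintype F] [Algebra (ZMod 2) F]

/-- If `s / d` and `l / d` are odd, then the quadratic parts are Hermitian forms over the field with
`2 ^ (2 * d)` elements, whose character sums are determined by their radicals. -/
theorem walshSum_quadratic_of_odd {s l d j : ℕ} (hF : Fintype.card F = 2 ^ (2 * s))
    (hl : l ≤ 2 * s) (hd0 : d ≠ 0) (hs : ∃ n, s = d * n ∧ Odd n) (hlk : ∃ k, l = d * k ∧ Odd k)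
    (a : subfieldTwoPow F s) (b : F)
    (hj : Nat.card (polarRadical s l (a : F) b) = 2 ^ (2 * (d * j))) :
    walshSum (kasamiWord s l hF a b 0 0) = -(-1) ^ j * 2 ^ (s + d * j) := by
  obtain ⟨n, hsn, hn⟩ := hs
  obtain ⟨k, hlk, hk⟩ := hlk
  have hds : 2 ^ d + 1 ∣ 2 ^ s + 1 := hsn ▸ two_pow_add_one_dvd_of_odd d hn
  have hdl : 2 ^ d + 1 ∣ 2 ^ l + 1 := hlk ▸ two_pow_add_one_dvd_of_odd d hk
  have hdvd : ((2 ^ d + 1 : ℕ) : ℤ) ∣ walshSum (kasamiWord s l hF a b 0 0) - 1 := by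
    refine dvd_walshSum_sub_one ?_ _ (kasamiWord_zero_right hF a b 0 0) ?_
    · rw [hF]
      refine hds.trans ⟨2 ^ s - 1, ?_⟩
      rw [mul_comm 2 s, pow_mul, ← Nat.sq_sub_sq, one_pow]
    · intro u x hu
      obtain ⟨r, hr⟩ := hds
      obtain ⟨t, ht⟩ := hdl
      have h1 : powToSubfield s hF (u * x) = powToSubfield s hF x := by
        apply Subtype.ext
        change (u * x) ^ (2 ^ s + 1) = x ^ (2 ^ s + 1)
        rw [mul_pow, hr, pow_mul u, hu, one_pow, one_mul]
      have h2 : (u * x) ^ (2 ^ l + 1) = x ^ (2 ^ l + 1) := by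
        rw [mul_pow, ht, pow_mul u, hu, one_pow, one_mul]
      simp only [kasamiWord, h1, h2, zero_mul]
  -- Since `2 ^ d` is `-1` and `s / d` is odd, the claimed value is `1` modulo `2 ^ d + 1`. The
  -- modulus is at least `3`, so the residue `1` rules out both `0` and the opposite sign.
  have hmod : (2 : ℤ) ^ d ≡ -1 [ZMOD (2 ^ d + 1 : ℕ)] := by
    rw [Int.modEq_iff_dvd]
    push_cast
    exact ⟨-1, by ring⟩
  have hpow : -(-1) ^ j * (2 : ℤ) ^ (s + d * j) ≡ 1 [ZMOD (2 ^ d + 1 : ℕ)] := by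
    have h1 := (hmod.pow (n + j)).mul_left (-(-1) ^ j)
    rw [← pow_mul, mul_add, ← hsn] at h1
    refine h1.trans ?_
    rw [pow_add, hn.neg_one_pow]
    have : -(-1 : ℤ) ^ j * (-1 * (-1) ^ j) = 1 := by
      rw [show -(-1 : ℤ) ^ j * (-1 * (-1) ^ j) = ((-1) * (-1)) ^ j by rw [mul_pow]; ring]
      norm_num
    rw [this]
  have hW : walshSum (kasamiWord s l hF a b 0 0) ≡ 1 [ZMOD (2 ^ d + 1 : ℕ)] :=
    (Int.modEq_iff_dvd.mpr hdvd).symm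
  have hbig : (3 : ℤ) ≤ (2 ^ d + 1 : ℕ) := by
    have : 2 ^ 1 ≤ 2 ^ d := Nat.pow_le_pow_right (by norm_num) (Nat.pos_of_ne_zero hd0)
    push_cast
    have : (2 : ℤ) ≤ 2 ^ d := by exact_mod_cast this
    linarith
  rcases walshSum_sq_eq_or hF hl a b 0 with h | h
  · exfalso
    rw [h] at hW
    have := Int.le_of_dvd (by norm_num) (Int.modEq_iff_dvd.mp hW)
    linarith
  · have hsq : walshSum (kasamiWord s l hF a b 0 0) ^ 2 =
        (-(-1) ^ j * 2 ^ (s + d * j)) ^ 2 := by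
      rw [h, hF, hj, mul_pow, neg_sq, ← pow_mul, mul_comm j 2, pow_mul (-1), neg_one_sq, one_pow, one_mul]
      push_cast
      rw [← pow_mul, ← pow_add]
      congr 1
      ring
    rcases sq_eq_sq_iff_eq_or_eq_neg.mp hsq with h1 | h1
    · exact h1
    · exfalso
      rw [h1] at hW
      have h2 := (hpow.neg.symm.trans hW)
      have := Int.le_of_dvd (by norm_num) (Int.modEq_iff_dvd.mp h2)
      linarith

end Sign

/-! ### Weights, character sums and design parameters. -/

section WeightsAndDesigns

variable {F : Type*} [Field F] [Fintype F] [Algebra (ZMod 2) F]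

theorem two_pow_sub_weight {n e : ℕ} (hn : 3 ≤ n) (he : 1 ≤ e) (hen : e < n) :
    2 ≤ 2 ^ (n - 1) - 2 ^ (e - 1) ∧ 2 ^ (n - 1) - 2 ^ (e - 1) ≤ 2 ^ n ∧
      (2 ^ n - 2 * (2 ^ (n - 1) - 2 ^ (e - 1) : ℕ) : ℤ) = 2 ^ e ∧
      ((2 ^ (n - 1) - 2 ^ (e - 1) : ℕ) : ℚ) = (2 ^ n - 2 ^ e) / 2 := by
  obtain ⟨n, rfl⟩ := Nat.exists_eq_add_of_le' (by omega : 1 ≤ n)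
  obtain ⟨e, rfl⟩ := Nat.exists_eq_add_of_le' he
  simp only [Nat.add_sub_cancel]
  have h1 : 2 ^ (e + 1) ≤ 2 ^ n := Nat.pow_le_pow_right (by norm_num) (by omega)
  have h2 : 2 ^ 2 ≤ 2 ^ n := Nat.pow_le_pow_right (by norm_num) (by omega)
  have h3 : 2 ^ (n + 1) = 2 * 2 ^ n := pow_succ' 2 n
  have h4 : 2 ^ (e + 1) = 2 * 2 ^ e := pow_succ' 2 e
  have h5 : 2 ^ e ≤ 2 ^ n := by omega
  refine ⟨by omega, by omega, ?_, ?_⟩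
  · push_cast [Nat.cast_sub h5]
    ring
  · push_cast [Nat.cast_sub h5]
    ring

theorem two_pow_add_weight {n e : ℕ} (hn : 3 ≤ n) (he : 1 ≤ e) (hen : e < n) :
    2 ≤ 2 ^ (n - 1) + 2 ^ (e - 1) ∧ 2 ^ (n - 1) + 2 ^ (e - 1) ≤ 2 ^ n ∧
      (2 ^ n - 2 * (2 ^ (n - 1) + 2 ^ (e - 1) : ℕ) : ℤ) = -2 ^ e ∧
      ((2 ^ (n - 1) + 2 ^ (e - 1) : ℕ) : ℚ) = (2 ^ n + 2 ^ e) / 2 := by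
  obtain ⟨n, rfl⟩ := Nat.exists_eq_add_of_le' (by omega : 1 ≤ n)
  obtain ⟨e, rfl⟩ := Nat.exists_eq_add_of_le' he
  simp only [Nat.add_sub_cancel]
  have h1 : 2 ^ (e + 1) ≤ 2 ^ n := Nat.pow_le_pow_right (by norm_num) (by omega)
  have h2 : 2 ^ 2 ≤ 2 ^ n := Nat.pow_le_pow_right (by norm_num) (by omega)
  have h3 : 2 ^ (n + 1) = 2 * 2 ^ n := pow_succ' 2 n
  have h4 : 2 ^ (e + 1) = 2 * 2 ^ e := pow_succ' 2 e
  refine ⟨by omega, by omega, ?_, ?_⟩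
  · push_cast
    ring
  · push_cast
    ring

/-- The two weights correspond to the character sums `2 ^ e` and `-2 ^ e`, which occur equally
often; hence a single count `A`, given through the square of the sum. -/
theorem holdsTwoDesign_sub_add {F : Type*} [Field F] [Fintype F]
    {C : Submodule (ZMod 2) (F → ZMod 2)}
    (hC : affinePerms F ⊆ permAut C) {n e : ℕ} (hF : Fintype.card F = 2 ^ n) (hn : 3 ≤ n)
    (he : 1 ≤ e) (hen : e < n) {A : ℚ}
    (hA : ∀ i : ℕ, (2 ^ n - 2 * i : ℤ) ^ 2 = (2 ^ e) ^ 2 →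
      ({w | w ∈ C ∧ hammingNorm w = i}.ncard : ℚ) = A) :
    (∀ lam : ℚ, lam * (2 ^ n * (2 ^ n - 1)) =
        A * ((2 ^ n - 2 ^ e) / 2 * ((2 ^ n - 2 ^ e) / 2 - 1)) →
      HoldsTwoDesign C (2 ^ n) (2 ^ (n - 1) - 2 ^ (e - 1)) lam) ∧
    (∀ lam : ℚ, lam * (2 ^ n * (2 ^ n - 1)) =
        A * ((2 ^ n + 2 ^ e) / 2 * ((2 ^ n + 2 ^ e) / 2 - 1)) →
      HoldsTwoDesign C (2 ^ n) (2 ^ (n - 1) + 2 ^ (e - 1)) lam) := by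
  constructor
  · intro lam hlam
    obtain ⟨h1, h2, h3, h4⟩ := two_pow_sub_weight hn he hen
    refine holdsTwoDesign_of_affine hC hF h1 h2 ?_
    rw [hA _ (by rw [h3]), h4]
    push_cast
    exact hlam
  · intro lam hlam
    obtain ⟨h1, h2, h3, h4⟩ := two_pow_add_weight hn he hen
    refine holdsTwoDesign_of_affine hC hF h1 h2 ?_
    rw [hA _ (by rw [h3, neg_sq]), h4]
    push_cast
    exact hlam

theorem holdsTwoDesign_half {F : Type*} [Field F] [Fintype F]
    {C : Submodule (ZMod 2) (F → ZMod 2)}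
    (hC : affinePerms F ⊆ permAut C) {n : ℕ} (hF : Fintype.card F = 2 ^ n) (hn : 3 ≤ n) {A lam : ℚ}
    (hA : ∀ i : ℕ, (2 ^ n - 2 * i : ℤ) = 0 →
      ({w | w ∈ C ∧ hammingNorm w = i}.ncard : ℚ) = A)
    (hlam : lam * (2 ^ n * (2 ^ n - 1)) = A * (2 ^ n / 2 * (2 ^ n / 2 - 1))) :
    HoldsTwoDesign C (2 ^ n) (2 ^ (n - 1)) lam := by
  have h0 : 2 ^ n = 2 * 2 ^ (n - 1) := by rw [← pow_succ']; congr 1; omega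
  have h1 : 2 ^ 1 ≤ 2 ^ (n - 1) := Nat.pow_le_pow_right (by norm_num) (by omega)
  have h2 : (2 : ℤ) ^ n = 2 * 2 ^ (n - 1) := by exact_mod_cast h0
  have h3 : (2 : ℚ) ^ n = 2 * 2 ^ (n - 1) := by exact_mod_cast h0
  refine holdsTwoDesign_of_affine hC hF (by omega) (by omega) ?_
  rw [hA _ (by push_cast; rw [h2, sub_self])]
  push_cast
  rw [hlam, h3, mul_div_cancel_left₀ _ two_ne_zero]

theorem exists_isDesign_kasamiCode {s l : ℕ} (hs : 2 ≤ s) (hl : l ≤ 2 * s - 1)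
    (hF : Fintype.card F = 2 ^ (2 * s)) {i : ℕ} (hi : i ≠ 0)
    (hw : ∃ w ∈ kasamiCode F s l hF, hammingNorm w = i) :
    ∃ lam : ℕ, IsDesign 2 (2 ^ (2 * s)) i lam (supportsOfWeight (kasamiCode F s l hF) i) := by
  obtain ⟨w, hw, rfl⟩ := hw
  -- A design with `t = 2` needs blocks of size at least two; weight one contradicts the parity
  -- check.
  have h1 : hammingNorm w ≠ 1 := by
    intro h1
    obtain ⟨e, b, c, h, rfl⟩ := mem_kasamiCode_iff_traceWord.mp hw
    have h2 := sum_traceWord hs hl hF e b c h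
    rw [← card_wordSupport, Finset.card_eq_one] at h1
    obtain ⟨x, hx⟩ := h1
    have h3 : ∀ y, traceWord s l e b c h y ≠ 0 ↔ y = x := by
      simpa [wordSupport, Finset.ext_iff] using hx
    rw [Finset.sum_eq_single x (fun y _ hy => not_not.mp fun h => hy ((h3 y).mp h))
      (fun h => absurd (Finset.mem_univ _) h)] at h2
    exact (h3 x).mpr rfl h2
  obtain ⟨n, hn, -⟩ := exists_isDesign_of_affine
    (affinePerms_subset_permAut_kasamiCode (l := l) hF (by omega))
    (i := hammingNorm w) (by omega) hammingNorm_le_card_fintype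
  exact ⟨n, hF ▸ hn⟩

end WeightsAndDesigns

/-! ### Solving for the class sizes in the two cases. -/

theorem theorem3p4 (F : Type*) [Field F] [Fintype F] [Algebra (ZMod 2) F]
    (s l d d' : ℕ) (hs : 2 ≤ s) (hl : 1 ≤ l) (hlm : l ≤ 2 * s - 1) (hls : l ≠ s)
    (hd : d = Nat.gcd s l) (hd' : d' = Nat.gcd (s + l) (2 * l))
    (hF : Fintype.card F = 2 ^ (2 * s)) :
    IsAffineInvariant (kasamiCode F s l hF) ∧
    (∀ i : ℕ, i ≠ 0 → (∃ w ∈ kasamiCode F s l hF, hammingNorm w = i) →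
      ∃ lam : ℕ, IsDesign 2 (2 ^ (2 * s)) i lam (supportsOfWeight (kasamiCode F s l hF) i)) ∧
    (d' = d →
      HoldsTwoDesign (kasamiCode F s l hF) (2 ^ (2 * s)) (2 ^ (2 * s - 1) - 2 ^ (s - 1))
        ((2 : ℚ) ^ (s - 1 : ℤ) * ((2 : ℚ) ^ (s : ℤ) - 1)
          * ((2 : ℚ) ^ (2 * s - 1 : ℤ) - (2 : ℚ) ^ (s - 1 : ℤ) - 1)
          * ((2 : ℚ) ^ (2 * (s + d) : ℤ) - (2 : ℚ) ^ (2 * s + d : ℤ) - (2 : ℚ) ^ (2 * s : ℤ)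
            + (2 : ℚ) ^ (s + 2 * d : ℤ) - (2 : ℚ) ^ (s + d : ℤ) + (2 : ℚ) ^ (2 * d : ℤ))
          / (((2 : ℚ) ^ (2 * d : ℤ) - 1) * ((2 : ℚ) ^ (s : ℤ) + 1))) ∧
      HoldsTwoDesign (kasamiCode F s l hF) (2 ^ (2 * s)) (2 ^ (2 * s - 1) + 2 ^ (s - 1))
        ((2 : ℚ) ^ (s - 1 : ℤ)
          * ((2 : ℚ) ^ (2 * s - 1 : ℤ) + (2 : ℚ) ^ (s - 1 : ℤ) - 1)
          * ((2 : ℚ) ^ (2 * (s + d) : ℤ) - (2 : ℚ) ^ (2 * s + d : ℤ) - (2 : ℚ) ^ (2 * s : ℤ)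
            + (2 : ℚ) ^ (s + 2 * d : ℤ) - (2 : ℚ) ^ (s + d : ℤ) + (2 : ℚ) ^ (2 * d : ℤ))
          / ((2 : ℚ) ^ (2 * d : ℤ) - 1)) ∧
      HoldsTwoDesign (kasamiCode F s l hF) (2 ^ (2 * s)) (2 ^ (2 * s - 1) - 2 ^ (s + d - 1))
        ((2 : ℚ) ^ (s - d - 1 : ℤ) * ((2 : ℚ) ^ (s - d : ℤ) - 1) * ((2 : ℚ) ^ (s + d : ℤ) - 1)
          * ((2 : ℚ) ^ (2 * s - 1 : ℤ) - (2 : ℚ) ^ (s + d - 1 : ℤ) - 1)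
          / ((2 : ℚ) ^ (2 * d : ℤ) - 1)) ∧
      HoldsTwoDesign (kasamiCode F s l hF) (2 ^ (2 * s)) (2 ^ (2 * s - 1) + 2 ^ (s + d - 1))
        ((2 : ℚ) ^ (s - d - 1 : ℤ) * ((2 : ℚ) ^ (s - d : ℤ) + 1) * ((2 : ℚ) ^ (s + d : ℤ) - 1)
          * ((2 : ℚ) ^ (2 * s - 1 : ℤ) + (2 : ℚ) ^ (s + d - 1 : ℤ) - 1)
          / ((2 : ℚ) ^ (2 * d : ℤ) - 1)) ∧
      HoldsTwoDesign (kasamiCode F s l hF) (2 ^ (2 * s)) (2 ^ (2 * s - 1))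
        (((2 : ℚ) ^ (2 * s - 1 : ℤ) - 1)
          * ((2 : ℚ) ^ (3 * s - d : ℤ) - (2 : ℚ) ^ (2 * s - 2 * d : ℤ) + 1))) ∧
    (d' = 2 * d →
      HoldsTwoDesign (kasamiCode F s l hF) (2 ^ (2 * s)) (2 ^ (2 * s - 1) - 2 ^ (s - 1))
        ((2 : ℚ) ^ (3 * d : ℤ)
          * ((2 : ℚ) ^ (2 * s : ℤ) - (2 : ℚ) ^ (2 * (s - d) : ℤ) - (2 : ℚ) ^ (2 * s - 3 * d : ℤ)
            + (2 : ℚ) ^ (s : ℤ) - (2 : ℚ) ^ (s - d : ℤ) + 1)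
          * ((2 : ℚ) ^ (2 * s - 1 : ℤ) - (2 : ℚ) ^ (s - 1 : ℤ) - 1)
          * ((2 : ℚ) ^ (2 * s - 1 : ℤ) - (2 : ℚ) ^ (s - 1 : ℤ))
          / (((2 : ℚ) ^ (2 * d : ℤ) - 1) * ((2 : ℚ) ^ (d : ℤ) + 1) * ((2 : ℚ) ^ (s : ℤ) + 1))) ∧
      HoldsTwoDesign (kasamiCode F s l hF) (2 ^ (2 * s)) (2 ^ (2 * s - 1) + 2 ^ (s - 1))
        ((2 : ℚ) ^ (3 * d : ℤ)
          * ((2 : ℚ) ^ (2 * s : ℤ) - (2 : ℚ) ^ (2 * (s - d) : ℤ) - (2 : ℚ) ^ (2 * s - 3 * d : ℤ)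
            + (2 : ℚ) ^ (s : ℤ) - (2 : ℚ) ^ (s - d : ℤ) + 1)
          * ((2 : ℚ) ^ (2 * s - 1 : ℤ) + (2 : ℚ) ^ (s - 1 : ℤ) - 1)
          * ((2 : ℚ) ^ (2 * s - 1 : ℤ) + (2 : ℚ) ^ (s - 1 : ℤ))
          / (((2 : ℚ) ^ (2 * d : ℤ) - 1) * ((2 : ℚ) ^ (d : ℤ) + 1) * ((2 : ℚ) ^ (s : ℤ) + 1))) ∧
      HoldsTwoDesign (kasamiCode F s l hF) (2 ^ (2 * s)) (2 ^ (2 * s - 1) - 2 ^ (s + d - 1))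
        (((2 : ℚ) ^ (s : ℤ) + (2 : ℚ) ^ (s - d : ℤ) + (2 : ℚ) ^ (s - 2 * d : ℤ) + 1)
          * ((2 : ℚ) ^ (2 * s - 1 : ℤ) - (2 : ℚ) ^ (s + d - 1 : ℤ))
          * ((2 : ℚ) ^ (2 * s - 1 : ℤ) - (2 : ℚ) ^ (s + d - 1 : ℤ) - 1)
          / ((2 : ℚ) ^ (d : ℤ) * ((2 : ℚ) ^ (d : ℤ) + 1) ^ 2)) ∧
      HoldsTwoDesign (kasamiCode F s l hF) (2 ^ (2 * s)) (2 ^ (2 * s - 1) + 2 ^ (s + d - 1))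
        (((2 : ℚ) ^ (s : ℤ) + (2 : ℚ) ^ (s - d : ℤ) + (2 : ℚ) ^ (s - 2 * d : ℤ) + 1)
          * ((2 : ℚ) ^ (2 * s - 1 : ℤ) + (2 : ℚ) ^ (s + d - 1 : ℤ))
          * ((2 : ℚ) ^ (2 * s - 1 : ℤ) + (2 : ℚ) ^ (s + d - 1 : ℤ) - 1)
          / ((2 : ℚ) ^ (d : ℤ) * ((2 : ℚ) ^ (d : ℤ) + 1) ^ 2)) ∧
      HoldsTwoDesign (kasamiCode F s l hF) (2 ^ (2 * s)) (2 ^ (2 * s - 1))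
        (((2 : ℚ) ^ (2 * s - 1 : ℤ) - 1)
          * ((2 : ℚ) ^ (3 * s - d : ℤ) - (2 : ℚ) ^ (3 * s - 2 * d : ℤ)
            + (2 : ℚ) ^ (3 * s - 3 * d : ℤ) - (2 : ℚ) ^ (3 * s - 4 * d : ℤ)
            + (2 : ℚ) ^ (3 * s - 5 * d : ℤ) + (2 : ℚ) ^ (2 * s - d : ℤ)
            - (2 : ℚ) ^ (2 * s - 2 * d + 1 : ℤ) + (2 : ℚ) ^ (2 * s - 3 * d : ℤ)
            - (2 : ℚ) ^ (2 * s - 4 * d : ℤ) + 1)) ∧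
      HoldsTwoDesign (kasamiCode F s l hF) (2 ^ (2 * s)) (2 ^ (2 * s - 1) - 2 ^ (s + 2 * d - 1))
        (((2 : ℚ) ^ (s - d : ℤ) - 1)
          * ((2 : ℚ) ^ (2 * s - 1 : ℤ) - (2 : ℚ) ^ (s + 2 * d - 1 : ℤ))
          * ((2 : ℚ) ^ (2 * s - 1 : ℤ) - (2 : ℚ) ^ (s + 2 * d - 1 : ℤ) - 1)
          / ((2 : ℚ) ^ (4 * d : ℤ) * ((2 : ℚ) ^ (d : ℤ) + 1) * ((2 : ℚ) ^ (2 * d : ℤ) - 1))) ∧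
      HoldsTwoDesign (kasamiCode F s l hF) (2 ^ (2 * s)) (2 ^ (2 * s - 1) + 2 ^ (s + 2 * d - 1))
        (((2 : ℚ) ^ (s - d : ℤ) - 1)
          * ((2 : ℚ) ^ (2 * s - 1 : ℤ) + (2 : ℚ) ^ (s + 2 * d - 1 : ℤ))
          * ((2 : ℚ) ^ (2 * s - 1 : ℤ) + (2 : ℚ) ^ (s + 2 * d - 1 : ℤ) - 1)
          / ((2 : ℚ) ^ (4 * d : ℤ) * ((2 : ℚ) ^ (d : ℤ) + 1) * ((2 : ℚ) ^ (2 * d : ℤ) - 1))))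
:= by
  have haff := affinePerms_subset_permAut_kasamiCode (l := l) hF (by omega)
  obtain ⟨hd1, hds⟩ := two_mul_le_of_gcd hl hlm hls hd
  have hdQ : (1 : ℚ) < 2 ^ d := one_lt_pow₀ (by norm_num) (by omega)
  have hsQ : (1 : ℚ) < 2 ^ s := one_lt_pow₀ (by norm_num) (by omega)
  refine ⟨isAffineInvariant_kasamiCode hs hlm hF,
    fun i hi hw => exists_isDesign_kasamiCode hs hlm hF hi hw, fun hdd => ?_, fun hdd => ?_⟩
  · have hcard : ∀ (a : subfieldTwoPow F s) (b : F), ¬ (a = 0 ∧ b = 0) →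
        ∃ j < 2, Nat.card (polarRadical s l (a : F) b) = 2 ^ (2 * (d * j)) := by
      intro a b hab
      rcases card_polarRadical_of_eq hF (by omega) (by omega) hd (hdd ▸ hd') hab with h | h
      · exact ⟨0, by norm_num, by simpa using h⟩
      · exact ⟨1, by norm_num, by simpa using h⟩
    obtain ⟨N, hN1, hN2, -, hA, hA0⟩ := exists_weight_distribution hF (by omega) (by omega)
      (fun j hj => by interval_cases j <;> omega) hcard
    simp only [Finset.sum_range_succ, Finset.sum_range_zero, mul_zero, mul_one, zero_add, pow_zero,
      ← hd] at hN1 hN2 hA0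
    have hD2 : ((2 : ℚ) ^ d) ^ 2 - 1 ≠ 0 := by nlinarith
    have hP1 : (2 : ℚ) ^ s + 1 ≠ 0 := by positivity
    have hN1' : N 1 = (((2 : ℚ) ^ s) ^ 2 - 1) * (2 ^ s * 2 ^ d - 1) / ((2 ^ d) ^ 2 - 1) := by
      rw [eq_div_iff hD2]
      simp only [mul_comm _ s, mul_comm _ d, pow_mul] at hN1 hN2
      linear_combination hN2 - hN1
    have hN0' : N 0 = ((2 : ℚ) ^ s) ^ 3 - 1 -
        (((2 : ℚ) ^ s) ^ 2 - 1) * (2 ^ s * 2 ^ d - 1) / ((2 ^ d) ^ 2 - 1) := by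
      rw [← hN1', ← pow_mul, mul_comm s 3]
      linear_combination hN1
    have h0 := holdsTwoDesign_sub_add haff (e := s) (A := N 0 * 2 ^ (2 * s)) hF (by omega) (by omega)
      (by omega) (fun i hi => by simpa using hA 0 (by norm_num) i (by simpa using hi))
    have h1 := holdsTwoDesign_sub_add haff (e := s + d) (A := N 1 * 2 ^ (2 * s) / 2 ^ (2 * d)) hF
      (by omega) (by omega) (by omega) (fun i hi => by
        rw [eq_div_iff (by positivity)]
        simpa using hA 1 (by norm_num) i (by simpa using hi))
    have h2 := fun lam hlam => holdsTwoDesign_half haff (lam := lam) hF (by omega) hA0 hlam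
    rw [hN0'] at h0
    rw [hN1'] at h1
    rw [hN0', hN1'] at h2
    refine ⟨h0.1 _ ?_, h0.2 _ ?_, h1.1 _ ?_, h1.2 _ ?_, h2 _ ?_⟩ <;>
    · simp only [zpow_sub₀ (two_ne_zero (α := ℚ)), zpow_add₀ (two_ne_zero (α := ℚ)), zpow_mul',
        zpow_natCast, zpow_ofNat, mul_comm _ s, mul_comm _ d, pow_mul, pow_add]
      generalize (2 : ℚ) ^ s = P at *
      generalize (2 : ℚ) ^ d = D at *
      have : P ≠ 0 := by positivity
      have : D ≠ 0 := by positivity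
      field_simp
      try ring
  · obtain ⟨n, k, hn, hk, hno, hko⟩ := odd_quotients_of_gcd (by omega) hd (hdd ▸ hd')
    -- `s / d` is odd and at least `2`, hence at least `3`. This keeps `2 * d < s`, so the largest
    -- radical is still proper.
    have h3d : 3 * d ≤ s := by
      obtain ⟨r, hr⟩ := hno
      have hr1 : r ≠ 0 := by
        rintro rfl
        simp only [hr, mul_zero, zero_add, mul_one] at hn
        omega
      have : d * 3 ≤ d * n := Nat.mul_le_mul_left _ (by omega)
      omega
    have hcard : ∀ (a : subfieldTwoPow F s) (b : F), ¬ (a = 0 ∧ b = 0) →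
        ∃ j < 3, Nat.card (polarRadical s l (a : F) b) = 2 ^ (2 * (d * j)) := by
      intro a b hab
      obtain ⟨j, hj, h⟩ := exists_card_polarRadical (a := (a : F)) (b := b) hF (by omega) hd'
        (by omega) (by simpa using hab)
      refine ⟨j, by omega, ?_⟩
      rw [h, hdd, ← pow_mul, mul_assoc]
    obtain ⟨N, hN1, hN2, hN3, hA, hA0⟩ := exists_weight_distribution hF (by omega) (by omega)
      (fun j hj => by interval_cases j <;> omega) hcard
    have hN3 := hN3 (fun j => -(-1) ^ j * 2 ^ (s + d * j)) (fun a b _ j hj =>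
      walshSum_quadratic_of_odd hF (by omega) (by omega) ⟨n, hn, hno⟩ ⟨k, hk, hko⟩ a b hj)
    push_cast at hN3
    simp only [Finset.sum_range_succ, Finset.sum_range_zero, mul_zero, mul_one, zero_add, pow_zero,
      ← hd] at hN1 hN2 hN3 hA0
    have hD1 : (2 : ℚ) ^ d + 1 ≠ 0 := by positivity
    have hD2 : ((2 : ℚ) ^ d) ^ 2 - 1 ≠ 0 := by nlinarith
    have hP0 : (2 : ℚ) ^ s ≠ 0 := by positivity
    have hD0 : (2 : ℚ) ^ d ≠ 0 := by positivity
    have hP1 : (2 : ℚ) ^ s + 1 ≠ 0 := by positivity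
    have e3 : (2 : ℚ) ^ (3 * s) = (2 ^ s) ^ 3 := by rw [← pow_mul, mul_comm]
    have e2 : (2 : ℚ) ^ (2 * s) = (2 ^ s) ^ 2 := by rw [← pow_mul, mul_comm]
    have ed2 : (2 : ℚ) ^ (2 * d) = (2 ^ d) ^ 2 := by rw [← pow_mul, mul_comm]
    have ed4 : (2 : ℚ) ^ (2 * (d * 2)) = (2 ^ d) ^ 4 := by rw [← pow_mul]; congr 1; ring
    have esd : (2 : ℚ) ^ (s + d) = 2 ^ s * 2 ^ d := pow_add _ _ _
    have esd2 : (2 : ℚ) ^ (s + d * 2) = 2 ^ s * (2 ^ d) ^ 2 := by rw [pow_add, pow_mul]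
    rw [e3] at hN1
    rw [e3, e2, ed2, ed4] at hN2
    rw [e3, e2, esd, esd2] at hN3
    have hN3 : (2 : ℚ) ^ s - N 0 + N 1 * 2 ^ d - N 2 * (2 ^ d) ^ 2 = (2 ^ s) ^ 2 := by
      refine mul_left_cancel₀ hP0 ?_
      linear_combination hN3
    -- Adding the signed equation removes `N 0` from the other two; the multiple `2 ^ d` then
    -- cancels `N 1`.
    have hN2' : N 2 = ((2 : ℚ) ^ s / 2 ^ d - 1) * ((2 ^ s) ^ 2 - 1) /
        ((2 ^ d + 1) * ((2 ^ d) ^ 2 - 1)) := by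
      field_simp
      linear_combination hN2 + hN3 - 2 ^ d * (hN1 + hN3)
    have hN1' : N 1 = ((2 : ℚ) ^ s + 2 ^ s / 2 ^ d + 2 ^ s / (2 ^ d) ^ 2 + 1) * 2 ^ d *
        ((2 ^ s) ^ 2 - 1) / (2 ^ d + 1) ^ 2 := by
      have h : (2 ^ d + 1) * N 1 = (2 ^ s) ^ 3 + (2 ^ s) ^ 2 - 2 ^ s - 1 +
          ((2 ^ d) ^ 2 - 1) * N 2 := by linear_combination hN1 + hN3
      rw [hN2'] at h
      field_simp at h ⊢
      linear_combination h
    have hN0' : N 0 = (2 ^ d) ^ 3 * ((2 ^ s) ^ 2 - (2 ^ s) ^ 2 / (2 ^ d) ^ 2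
        - (2 ^ s) ^ 2 / (2 ^ d) ^ 3 + 2 ^ s - 2 ^ s / 2 ^ d + 1) * ((2 : ℚ) ^ s - 1) /
        (((2 ^ d) ^ 2 - 1) * (2 ^ d + 1)) := by
      have h : N 0 = (2 ^ s) ^ 3 - 1 - N 1 - N 2 := by linear_combination hN1
      rw [h, hN1', hN2']
      field_simp
      ring
    have h0 := holdsTwoDesign_sub_add haff (e := s) (A := N 0 * 2 ^ (2 * s)) hF (by omega) (by omega)
      (by omega) (fun i hi => by simpa using hA 0 (by norm_num) i (by simpa using hi))
    have h1 := holdsTwoDesign_sub_add haff (e := s + d) (A := N 1 * 2 ^ (2 * s) / 2 ^ (2 * d)) hF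
      (by omega) (by omega) (by omega) (fun i hi => by
        rw [eq_div_iff (by positivity)]
        simpa using hA 1 (by norm_num) i (by simpa using hi))
    have h2 := holdsTwoDesign_sub_add haff (e := s + 2 * d)
      (A := N 2 * 2 ^ (2 * s) / 2 ^ (2 * (d * 2))) hF
      (by omega) (by omega) (by omega) (fun i hi => by
        rw [eq_div_iff (by positivity)]
        exact hA 2 (by norm_num) i (by rw [hi, mul_comm d 2]))
    have h3 := fun lam hlam => holdsTwoDesign_half haff (lam := lam) hF (by omega) hA0 hlam
    rw [hN0'] at h0
    rw [hN1'] at h1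
    rw [hN2', ed4] at h2
    rw [hN0', hN1', hN2', ed4] at h3
    -- Each remaining goal is an identity of rational functions in `P = 2 ^ s` and `D = 2 ^ d`.
    refine ⟨h0.1 _ ?_, h0.2 _ ?_, h1.1 _ ?_, h1.2 _ ?_, h3 _ ?_, h2.1 _ ?_, h2.2 _ ?_⟩ <;>
    · simp only [zpow_sub₀ (two_ne_zero (α := ℚ)), zpow_add₀ (two_ne_zero (α := ℚ)), zpow_mul',
        zpow_natCast, zpow_ofNat, mul_comm _ s, mul_comm _ d, pow_mul, pow_add]
      generalize (2 : ℚ) ^ s = P at *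
      generalize (2 : ℚ) ^ d = D at *
      field_simp
      try ring
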